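/- Let $\omega=e^{\pi i/4}$ and $$X=\begin{bmatrix}0&1\\1&0\end{bmatrix},\quad Z=\begin{bmatrix}1&0\\0&-1\end{bmatrix},\quad H=\tfrac1{\sqrt2}\begin{bmatrix}1&1\\1&-1\end{bmatrix},\quad S=\begin{bmatrix}1&0\\0&\omega^2\end{bmatrix},\quad CZ=\mathrm{diag}(1,1,1,-1).$$ For $n\ge 1$ and a $2\times2$ matrix $U$ put $U_i=I_2^{\otimes(i-1)}\otimes U\otimes I_2^{\otimes(n-i)}$ $(1\le i\le n)$ and $CZ_{i\to i+1}=I_2^{\otimes(i-1)}\otimes CZ\otimes I_2^{\otimes(n-i-1)}$ $(1\le i\le n-1)$. Let $\mathrm{Pauli}_n=\langle X_1,\dots,X_n,Z_1,\dots,Z_n,\omega^2I\rangle$, let $\mathrm{Cliff}_n$ be its normalizer in the unitary group $U(2^n)$, and let $\mathcal C_n=\mathrm{Cliff}_n/\langle\omega I\rangle$, where products in $\mathcal C_n$ are written from left to right (the opposite of the order of matrix multiplication). Let $h_i,s_i,\Lambda_i\in\mathcal C_n$ be the classes of $H_i,S_i,CZ_{i\to i+1}$, and for $n\ge2$ let $M=h_2\Lambda_1s_2^2h_2h_1s_1^2h_2\Lambda_1h_2$.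 Define the subgroups $\mathcal{IN}_n$ and $F_n$ of $\mathcal C_n$ by $$\mathcal{IN}_n=\begin{cases}\langle h_1,\ s_1^3h_1s_1h_1s_1\rangle,&n=1,\\ \langle h_1,h_2,s_2,h_1s_1^2h_1,M\rangle,&n=2,\\ \langle h_1,\dots,h_n,\ s_2,\dots,s_n,\ M,\ \Lambda_2,\dots,\Lambda_{n-1}\rangle,&n\ge3,\end{cases}$$ $$F_n=\begin{cases}\langle s_1^3h_1s_1h_1s_1\rangle,&n=1,\\ \langle h_2,s_2,h_1s_1^2h_1,M\rangle,&n=2,\\ \langle h_2,\dots,h_n,\ s_2,\dots,s_n,\ M,\ \Lambda_2,\dots,\Lambda_{n-1}\rangle,&n\ge3.\end{cases}$$ Then, for every $n\ge1$, the group $\mathcal{IN}_n$ is finite and $F_n$ is a normal subgroup of $\mathcal{IN}_n$ of order $|\mathcal{IN}_n|/2$. -/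

import Mathlib

open scoped Matrix

namespace QubitClifford

noncomputable section

/-- The primitive eighth root of unity `ω = exp (π i / 4)`; thus `ω ^ 2 = i`. -/
def omega : ℂ := Complex.exp (Real.pi * Complex.I / 4)

theorem omega_sq : omega ^ 2 = Complex.I := by
  have h : ((2 : ℕ) : ℂ) * (Real.pi * Complex.I / 4) = Real.pi / 2 * Complex.I := by
    push_cast
    ring
  rw [omega, ← Complex.exp_nat_mul, h, Complex.exp_pi_div_two_mul_I]

theorem star_omega_mul : star omega * omega = 1 := by
  have h : star omega = Complex.exp (-(Real.pi * Complex.I / 4)) := by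
    rw [omega, Complex.star_def, ← Complex.exp_conj]
    congr 1
    have h4 : (starRingEnd ℂ) 4 = 4 := Complex.conj_ofNat 4
    simp [neg_div, h4]
  rw [h, omega, ← Complex.exp_add]
  simp

/-! ### One- and two-qubit gates -/

/-- The group of `2 × 2` unitary matrices. -/
abbrev U2 := Matrix.unitaryGroup (Fin 2) ℂ

/-- The unitary group `U(2 ^ n)`; the computational basis of `n` qubits is indexed by the bit
strings `Fin n → Fin 2`. -/
abbrev UN (n : ℕ) := Matrix.unitaryGroup (Fin n → Fin 2) ℂ

def matX : Matrix (Fin 2) (Fin 2) ℂ := !![0, 1; 1, 0]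

def matZ : Matrix (Fin 2) (Fin 2) ℂ := !![1, 0; 0, -1]

def matH : Matrix (Fin 2) (Fin 2) ℂ := ((1 / Real.sqrt 2 : ℝ) : ℂ) • !![1, 1; 1, -1]

def matS : Matrix (Fin 2) (Fin 2) ℂ := !![1, 0; 0, omega ^ 2]

/-- The controlled `Z` gate; the basis of two qubits is indexed by pairs of bits. -/
def matCZ : Matrix (Fin 2 × Fin 2) (Fin 2 × Fin 2) ℂ :=
  Matrix.diagonal fun p => if p = (1, 1) then -1 else 1

theorem sqrt_two_inv_sq : ((1 / Real.sqrt 2 : ℝ) : ℂ) * ((1 / Real.sqrt 2 : ℝ) : ℂ) = 1 / 2 := by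
  rw [← Complex.ofReal_mul]
  have h : (1 / Real.sqrt 2) * (1 / Real.sqrt 2) = (1 / 2 : ℝ) := by
    rw [div_mul_div_comm, Real.mul_self_sqrt (by norm_num)]
    norm_num
  rw [h]
  norm_num

theorem matH_mul_self : matH * matH = 1 := by
  rw [matH, Matrix.smul_mul, Matrix.mul_smul, smul_smul, sqrt_two_inv_sq]
  ext a b
  fin_cases a <;> fin_cases b <;> norm_num [Matrix.mul_apply, Fin.sum_univ_two]

theorem star_matH : star matH = matH := by
  ext a b
  fin_cases a <;> fin_cases b <;> simp [matH, Matrix.star_apply]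

def gX : U2 := ⟨matX, by
  rw [Matrix.mem_unitaryGroup_iff]
  ext a b
  fin_cases a <;> fin_cases b <;> simp [matX, Matrix.mul_apply, Fin.sum_univ_two]⟩

def gZ : U2 := ⟨matZ, by
  rw [Matrix.mem_unitaryGroup_iff]
  ext a b
  fin_cases a <;> fin_cases b <;> simp [matZ, Matrix.mul_apply, Fin.sum_univ_two]⟩

def gH : U2 := ⟨matH, by
  rw [Matrix.mem_unitaryGroup_iff, star_matH, matH_mul_self]⟩

def gS : U2 := ⟨matS, by
  rw [Matrix.mem_unitaryGroup_iff]
  ext a b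
  fin_cases a <;> fin_cases b <;> simp [matS, omega_sq, Matrix.mul_apply, Fin.sum_univ_two]⟩

/-- The tensor (Kronecker) product `A 0 ⊗ A 1 ⊗ ⋯ ⊗ A (n - 1)` of `2 × 2` matrices. -/
def tensor {n : ℕ} (A : Fin n → Matrix (Fin 2) (Fin 2) ℂ) :
    Matrix (Fin n → Fin 2) (Fin n → Fin 2) ℂ :=
  Matrix.of fun x y => ∏ j, A j (x j) (y j)

theorem tensor_mul {n : ℕ} (A B : Fin n → Matrix (Fin 2) (Fin 2) ℂ) :
    tensor A * tensor B = tensor (fun j => A j * B j) := by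
  ext x y
  simp only [tensor, Matrix.mul_apply, Matrix.of_apply, Finset.prod_univ_sum,
    Fintype.piFinset_univ, Finset.prod_mul_distrib]

theorem tensor_one {n : ℕ} :
    tensor (fun _ : Fin n => (1 : Matrix (Fin 2) (Fin 2) ℂ)) = 1 := by
  ext x y
  by_cases h : x = y
  · subst h
    simp [tensor]
  · obtain ⟨j, hj⟩ := Function.ne_iff.1 h
    rw [Matrix.one_apply_ne h, tensor, Matrix.of_apply]
    exact Finset.prod_eq_zero (Finset.mem_univ j) (Matrix.one_apply_ne hj)

theorem star_tensor {n : ℕ} (A : Fin n → Matrix (Fin 2) (Fin 2) ℂ) :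
    star (tensor A) = tensor (fun j => star (A j)) := by
  ext x y
  simp [tensor, Matrix.star_apply]

/-- The tensor product of unitary matrices, as a group homomorphism. -/
def tensorHom (n : ℕ) : (Fin n → U2) →* UN n where
  toFun A := ⟨tensor fun j => (A j : Matrix (Fin 2) (Fin 2) ℂ), by
    rw [Matrix.mem_unitaryGroup_iff, star_tensor, tensor_mul, ← tensor_one]
    congr 1
    funext j
    exact Matrix.mem_unitaryGroup_iff.1 (A j).2⟩
  map_one' := Subtype.ext tensor_one
  map_mul' A B := Subtype.ext (tensor_mul _ _).symm

/-- `U_i = I ⊗ ⋯ ⊗ I ⊗ U ⊗ I ⊗ ⋯ ⊗ I`, the gate `U` acting on the qubit `i`. -/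
def onQubit {n : ℕ} (U : U2) (i : Fin n) : UN n := tensorHom n (Pi.mulSingle i U)

/-- `I ⊗ ⋯ ⊗ I ⊗ G ⊗ I ⊗ ⋯ ⊗ I`, with the `4 × 4` matrix `G` acting on the qubits `i`, `i + 1`. -/
def onPair {k : ℕ} (G : Matrix (Fin 2 × Fin 2) (Fin 2 × Fin 2) ℂ) (i : Fin k) :
    Matrix (Fin (k + 1) → Fin 2) (Fin (k + 1) → Fin 2) ℂ :=
  Matrix.of fun x y =>
    G (x i.castSucc, x i.succ) (y i.castSucc, y i.succ) *
      ∏ j ∈ Finset.univ \ {i.castSucc, i.succ}, (1 : Matrix (Fin 2) (Fin 2) ℂ) (x j) (y j)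

/-- The diagonal entries of the controlled `Z` gate on the qubits `i`, `i + 1`. -/
def czSign {k : ℕ} (i : Fin k) (x : Fin (k + 1) → Fin 2) : ℂ :=
  if (x i.castSucc, x i.succ) = (1, 1) then -1 else 1

theorem onPair_matCZ {k : ℕ} (i : Fin k) : onPair matCZ i = Matrix.diagonal (czSign i) := by
  ext x y
  by_cases h : x = y
  · subst h
    simp [onPair, matCZ, czSign]
  · rw [Matrix.diagonal_apply_ne _ h, onPair, Matrix.of_apply]
    obtain ⟨j, hj⟩ := Function.ne_iff.1 h
    by_cases hm : j ∈ Finset.univ \ {i.castSucc, i.succ}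
    · exact mul_eq_zero_of_right _ (Finset.prod_eq_zero hm (Matrix.one_apply_ne hj))
    · have h2 : (x i.castSucc, x i.succ) ≠ (y i.castSucc, y i.succ) := by
        intro he
        simp only [Prod.mk.injEq] at he
        simp only [Finset.mem_sdiff, Finset.mem_univ, true_and, Finset.mem_insert,
          Finset.mem_singleton, not_not] at hm
        rcases hm with rfl | rfl
        · exact hj he.1
        · exact hj he.2
      rw [matCZ, Matrix.diagonal_apply_ne _ h2, zero_mul]

theorem czSign_mul_self {k : ℕ} (i : Fin k) (x : Fin (k + 1) → Fin 2) :
    czSign i x * czSign i x = 1 := by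
  unfold czSign
  split_ifs <;> norm_num

/-- The controlled `Z` gate on the qubits `i`, `i + 1`. -/
def uCZ {k : ℕ} (i : Fin k) : UN (k + 1) := ⟨onPair matCZ i, by
  rw [Matrix.mem_unitaryGroup_iff, onPair_matCZ, Matrix.star_eq_conjTranspose,
    Matrix.diagonal_conjTranspose, Matrix.diagonal_mul_diagonal, ← Matrix.diagonal_one]
  congr 1
  funext x
  have h : star (czSign i) x = czSign i x := by
    simp only [Pi.star_apply, czSign]
    split_ifs <;> simp
  rw [h, czSign_mul_self]⟩

/-- The scalar matrix `ω I`. -/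
def omegaI (n : ℕ) : UN n := ⟨omega • 1, by
  rw [Matrix.mem_unitaryGroup_iff', star_smul, star_one, Matrix.smul_mul, Matrix.one_mul,
    smul_smul, star_omega_mul, one_smul]⟩

theorem omegaI_comm {n : ℕ} (U : UN n) : U * omegaI n = omegaI n * U := by
  apply Subtype.ext
  simp [omegaI]

/-! ### Pauli and Clifford groups -/

/-- The `n`-qubit Pauli group. -/
def Pauli (n : ℕ) : Subgroup (UN n) :=
  Subgroup.closure
    (Set.range (fun i : Fin n => onQubit gX i) ∪ Set.range (fun i : Fin n => onQubit gZ i) ∪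
      {omegaI n ^ 2})

/-- The `n`-qubit Clifford group: the normalizer of the Pauli group in the unitary group. -/
def Cliff (n : ℕ) : Subgroup (UN n) := Subgroup.normalizer (Pauli n : Set (UN n))

theorem onQubit_gX_mem {n : ℕ} (i : Fin n) : onQubit gX i ∈ Pauli n :=
  Subgroup.subset_closure (Or.inl (Or.inl ⟨i, rfl⟩))

theorem onQubit_gZ_mem {n : ℕ} (i : Fin n) : onQubit gZ i ∈ Pauli n :=
  Subgroup.subset_closure (Or.inl (Or.inr ⟨i, rfl⟩))

theorem omegaI_sq_mem (n : ℕ) : omegaI n ^ 2 ∈ Pauli n :=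
  Subgroup.subset_closure (Or.inr rfl)

theorem conj_mem_Pauli {n : ℕ} {U : UN n}
    (hX : ∀ i, U * onQubit gX i * U⁻¹ ∈ Pauli n) (hZ : ∀ i, U * onQubit gZ i * U⁻¹ ∈ Pauli n)
    {P : UN n} (hP : P ∈ Pauli n) : U * P * U⁻¹ ∈ Pauli n := by
  have h : Pauli n ≤ (Pauli n).comap (MulAut.conj U).toMonoidHom := by
    conv_lhs => rw [Pauli]
    rw [Subgroup.closure_le]
    rintro P ((⟨i, rfl⟩ | ⟨i, rfl⟩) | rfl)
    · simpa using hX i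
    · simpa using hZ i
    · have hc : Commute U (omegaI n ^ 2) := Commute.pow_right (omegaI_comm U) 2
      have he : U * omegaI n ^ 2 * U⁻¹ = omegaI n ^ 2 := by rw [hc.eq, mul_inv_cancel_right]
      simpa [he] using omegaI_sq_mem n
  simpa using h hP

theorem mem_Cliff_of_conj {n : ℕ} {U : UN n} {m : ℕ} (hm : U ^ (m + 1) = 1)
    (hX : ∀ i, U * onQubit gX i * U⁻¹ ∈ Pauli n)
    (hZ : ∀ i, U * onQubit gZ i * U⁻¹ ∈ Pauli n) : U ∈ Cliff n := by
  have hpow : ∀ (r : ℕ) (P : UN n), P ∈ Pauli n → U ^ r * P * (U ^ r)⁻¹ ∈ Pauli n := by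
    intro r
    induction r with
    | zero => intro P hP; simpa using hP
    | succ r ih =>
      intro P hP
      have h := conj_mem_Pauli hX hZ (ih P hP)
      have he : U ^ (r + 1) * P * (U ^ (r + 1))⁻¹ = U * (U ^ r * P * (U ^ r)⁻¹) * U⁻¹ := by
        rw [pow_succ']
        group
      rwa [he]
  rw [Cliff, Subgroup.mem_normalizer_iff]
  intro P
  refine ⟨fun hP => conj_mem_Pauli hX hZ hP, fun hP => ?_⟩
  have h := hpow m _ hP
  have he : U ^ m * (U * P * U⁻¹) * (U ^ m)⁻¹ = U ^ (m + 1) * P * (U ^ (m + 1))⁻¹ := by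
    rw [pow_succ]
    group
  rw [he, hm] at h
  simpa using h

theorem onQubit_mul {n : ℕ} (U V : U2) (i : Fin n) :
    onQubit U i * onQubit V i = onQubit (U * V) i := by
  simp only [onQubit, ← map_mul, Pi.mulSingle_mul]

theorem onQubit_one {n : ℕ} (i : Fin n) : onQubit 1 i = (1 : UN n) := by
  simp [onQubit]

theorem onQubit_inv {n : ℕ} (U : U2) (i : Fin n) : (onQubit U i)⁻¹ = onQubit U⁻¹ i := by
  rw [inv_eq_iff_mul_eq_one, onQubit_mul, mul_inv_cancel, onQubit_one]

theorem onQubit_pow {n : ℕ} (U : U2) (i : Fin n) (m : ℕ) :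
    onQubit U i ^ m = onQubit (U ^ m) i := by
  induction m with
  | zero => simp [onQubit_one]
  | succ m ih => rw [pow_succ, pow_succ, ih, onQubit_mul]

theorem onQubit_commute {n : ℕ} (U V : U2) {i j : Fin n} (h : i ≠ j) :
    onQubit U i * onQubit V j = onQubit V j * onQubit U i := by
  simp only [onQubit, ← map_mul]
  exact congrArg _ (Pi.mulSingle_commute (f := fun _ : Fin n => U2) h U V).eq

theorem onQubit_conj {n : ℕ} (U V : U2) (i j : Fin n) :
    onQubit U i * onQubit V j * (onQubit U i)⁻¹ =
      if i = j then onQubit (U * V * U⁻¹) j else onQubit V j := by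
  split_ifs with h
  · subst h
    rw [onQubit_inv, onQubit_mul, onQubit_mul]
  · rw [onQubit_commute U V h, mul_inv_cancel_right]

theorem gH_sq : gH ^ 2 = 1 := by
  rw [pow_two]
  exact Subtype.ext matH_mul_self

theorem gH_conj_gX : gH * gX * gH⁻¹ = gZ := by
  rw [mul_inv_eq_iff_eq_mul]
  apply Subtype.ext
  ext a b
  fin_cases a <;> fin_cases b <;>
    simp [gH, gX, gZ, matH, matX, matZ]

theorem gH_conj_gZ : gH * gZ * gH⁻¹ = gX := by
  rw [mul_inv_eq_iff_eq_mul]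
  apply Subtype.ext
  ext a b
  fin_cases a <;> fin_cases b <;>
    simp [gH, gX, gZ, matH, matX, matZ]

theorem gS_pow : gS ^ 4 = 1 := by
  apply Subtype.ext
  change matS ^ 4 = 1
  ext a b
  rw [matS, omega_sq]
  fin_cases a <;> fin_cases b <;> simp [pow_succ]

theorem gS_conj_gZ : gS * gZ * gS⁻¹ = gZ := by
  rw [mul_inv_eq_iff_eq_mul]
  apply Subtype.ext
  ext a b
  fin_cases a <;> fin_cases b <;>
    simp [gS, gZ, matS, matZ]

theorem onQubit_gS_conj_gX {n : ℕ} (i : Fin n) :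
    onQubit (gS * gX * gS⁻¹) i = omegaI n ^ 2 * (onQubit gX i * onQubit gZ i) := by
  rw [onQubit_mul]
  apply Subtype.ext
  ext x y
  have h1 : ((omegaI n ^ 2 * onQubit (gX * gZ) i : UN n) : Matrix _ _ ℂ) x y =
      Complex.I * ((onQubit (gX * gZ) i : UN n) : Matrix _ _ ℂ) x y := by
    simp [omegaI, pow_two, ← omega_sq, mul_assoc]
  rw [h1]
  simp only [onQubit, tensorHom, tensor, MonoidHom.coe_mk, OneHom.coe_mk, Matrix.of_apply]
  rw [← Finset.mul_prod_erase _ _ (Finset.mem_univ i),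
    ← Finset.mul_prod_erase (a := i) (f := fun j =>
      ((Pi.mulSingle i (gX * gZ) : Fin n → U2) j : Matrix (Fin 2) (Fin 2) ℂ) (x j) (y j))
      _ (Finset.mem_univ i), ← mul_assoc]
  congr 1
  · have h2 : ((gS * gX * gS⁻¹ : U2) : Matrix (Fin 2) (Fin 2) ℂ) =
        Complex.I • ((gX * gZ : U2) : Matrix (Fin 2) (Fin 2) ℂ) := by
      ext a b
      fin_cases a <;> fin_cases b <;>
        simp [gS, gX, gZ, matS, matX, matZ, omega_sq, Matrix.mul_apply, Fin.sum_univ_two,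
          Matrix.star_apply]
    simp only [Pi.mulSingle_eq_same]
    rw [h2]
    rfl
  · refine Finset.prod_congr rfl fun j hj => ?_
    have hne : j ≠ i := Finset.ne_of_mem_erase hj
    rw [Pi.mulSingle_eq_of_ne hne, Pi.mulSingle_eq_of_ne hne]

theorem onQubit_gH_mem {n : ℕ} (i : Fin n) : onQubit gH i ∈ Cliff n := by
  refine mem_Cliff_of_conj (m := 1) ?_ (fun j => ?_) (fun j => ?_)
  · rw [onQubit_pow, gH_sq, onQubit_one]
  · rw [onQubit_conj, gH_conj_gX]
    split_ifs
    exacts [onQubit_gZ_mem j, onQubit_gX_mem j]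
  · rw [onQubit_conj, gH_conj_gZ]
    split_ifs
    exacts [onQubit_gX_mem j, onQubit_gZ_mem j]

theorem onQubit_gS_mem {n : ℕ} (i : Fin n) : onQubit gS i ∈ Cliff n := by
  refine mem_Cliff_of_conj (m := 3) ?_ (fun j => ?_) (fun j => ?_)
  · rw [onQubit_pow, gS_pow, onQubit_one]
  · rw [onQubit_conj, onQubit_gS_conj_gX]
    split_ifs
    · exact mul_mem (omegaI_sq_mem n) (mul_mem (onQubit_gX_mem j) (onQubit_gZ_mem j))
    · exact onQubit_gX_mem j
  · rw [onQubit_conj, gS_conj_gZ]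
    split_ifs <;> exact onQubit_gZ_mem j

theorem uCZ_mul_self {k : ℕ} (i : Fin k) : uCZ i * uCZ i = 1 := by
  apply Subtype.ext
  change onPair matCZ i * onPair matCZ i = 1
  rw [onPair_matCZ, Matrix.diagonal_mul_diagonal, ← Matrix.diagonal_one]
  congr 1
  funext x
  exact czSign_mul_self i x

theorem uCZ_mul_apply {k : ℕ} (i : Fin k) (U : UN (k + 1)) (x y : Fin (k + 1) → Fin 2) :
    ((uCZ i * U : UN (k + 1)) : Matrix _ _ ℂ) x y = czSign i x * (U : Matrix _ _ ℂ) x y := by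
  change (onPair matCZ i * (U : Matrix (Fin (k + 1) → Fin 2) (Fin (k + 1) → Fin 2) ℂ) : Matrix (Fin (k + 1) → Fin 2) (Fin (k + 1) → Fin 2) ℂ) x y = _
  rw [onPair_matCZ, Matrix.diagonal_mul]

theorem mul_uCZ_apply {k : ℕ} (i : Fin k) (U : UN (k + 1)) (x y : Fin (k + 1) → Fin 2) :
    ((U * uCZ i : UN (k + 1)) : Matrix _ _ ℂ) x y = (U : Matrix _ _ ℂ) x y * czSign i y := by
  change ((U : Matrix (Fin (k + 1) → Fin 2) (Fin (k + 1) → Fin 2) ℂ) * onPair matCZ i : Matrix (Fin (k + 1) → Fin 2) (Fin (k + 1) → Fin 2) ℂ) x y = _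
  rw [onPair_matCZ, Matrix.mul_diagonal]

theorem onQubit_apply {n : ℕ} (U : U2) (i : Fin n) (x y : Fin n → Fin 2) :
    ((onQubit U i : UN n) : Matrix _ _ ℂ) x y =
      (U : Matrix (Fin 2) (Fin 2) ℂ) (x i) (y i) * if ∀ j, j ≠ i → x j = y j then 1 else 0 := by
  simp only [onQubit, tensorHom, tensor, MonoidHom.coe_mk, OneHom.coe_mk, Matrix.of_apply]
  rw [← Finset.mul_prod_erase _ _ (Finset.mem_univ i), Pi.mulSingle_eq_same]
  congr 1
  split_ifs with h
  · refine Finset.prod_eq_one fun j hj => ?_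
    have hne : j ≠ i := Finset.ne_of_mem_erase hj
    rw [Pi.mulSingle_eq_of_ne hne, h j hne]
    simp
  · push Not at h
    obtain ⟨j, hne, hj⟩ := h
    refine Finset.prod_eq_zero (Finset.mem_erase.2 ⟨hne, Finset.mem_univ j⟩) ?_
    rw [Pi.mulSingle_eq_of_ne hne]
    simp [hj]

theorem onQubit_gZ_mul_apply {n : ℕ} (i : Fin n) (U : UN n) (x y : Fin n → Fin 2) :
    ((onQubit gZ i * U : UN n) : Matrix _ _ ℂ) x y =
      (if x i = 1 then -1 else 1) * (U : Matrix _ _ ℂ) x y := by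
  have h : ((onQubit gZ i : UN n) : Matrix _ _ ℂ) =
      Matrix.diagonal fun x : Fin n → Fin 2 => if x i = 1 then (-1 : ℂ) else 1 := by
    ext x y
    rw [onQubit_apply]
    by_cases hxy : x = y
    · subst hxy
      rw [Matrix.diagonal_apply_eq]
      generalize x i = a
      fin_cases a <;> simp [gZ, matZ]
    · rw [Matrix.diagonal_apply_ne _ hxy]
      split_ifs with hj
      · have hi : x i ≠ y i := by
          intro hi
          apply hxy
          funext j
          by_cases hji : j = i
          · rw [hji, hi]
          · exact hj j hji
        generalize x i = a at hi
        generalize y i = b at hi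
        fin_cases a <;> fin_cases b <;> simp [gZ, matZ] at hi ⊢
      · simp
  change (((onQubit gZ i : UN n) : Matrix (Fin n → Fin 2) (Fin n → Fin 2) ℂ) * (U : Matrix (Fin n → Fin 2) (Fin n → Fin 2) ℂ) :
    Matrix (Fin n → Fin 2) (Fin n → Fin 2) ℂ) x y = _
  rw [h, Matrix.diagonal_mul]

theorem uCZ_conj_gZ {k : ℕ} (i : Fin k) (j : Fin (k + 1)) :
    uCZ i * onQubit gZ j * (uCZ i)⁻¹ = onQubit gZ j := by
  rw [mul_inv_eq_iff_eq_mul]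
  apply Subtype.ext
  ext x y
  rw [uCZ_mul_apply, onQubit_gZ_mul_apply, ← mul_one (onQubit gZ j), onQubit_gZ_mul_apply]
  by_cases h : x = y
  · subst h
    change _ = _ * (onPair matCZ i) x x
    rw [onPair_matCZ, Matrix.diagonal_apply_eq]
    simp [mul_comm]
  · change _ = _ * (onPair matCZ i) x y
    rw [onPair_matCZ, Matrix.diagonal_apply_ne _ h]
    simp [Matrix.one_apply_ne h]

theorem uCZ_conj_gX {k : ℕ} (i : Fin k) (j : Fin (k + 1)) :
    uCZ i * onQubit gX j * (uCZ i)⁻¹ =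
      if j = i.castSucc then onQubit gZ i.succ * onQubit gX j
      else if j = i.succ then onQubit gZ i.castSucc * onQubit gX j else onQubit gX j := by
  have hne : i.castSucc ≠ i.succ := (Fin.castSucc_lt_succ (i := i)).ne
  rw [mul_inv_eq_iff_eq_mul]
  apply Subtype.ext
  ext x y
  rw [uCZ_mul_apply, mul_uCZ_apply]
  have hX : ((onQubit gX j : UN (k + 1)) : Matrix _ _ ℂ) x y =
      if (x j ≠ y j ∧ ∀ l, l ≠ j → x l = y l) then 1 else 0 := by
    rw [onQubit_apply]
    generalize x j = a
    generalize y j = b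
    by_cases h : ∀ l, l ≠ j → x l = y l
    · fin_cases a <;> fin_cases b <;> simp [gX, matX, h]
    · simp [h]
  by_cases hxy : x j ≠ y j ∧ ∀ l, l ≠ j → x l = y l
  · rw [if_pos hxy] at hX
    obtain ⟨ha, hb⟩ := hxy
    by_cases h1 : j = i.castSucc
    · rw [if_pos h1, onQubit_gZ_mul_apply, hX]
      clear hX
      subst h1
      simp only [czSign, ← hb i.succ hne.symm]
      generalize x i.castSucc = a at ha ⊢
      generalize y i.castSucc = b at ha ⊢
      generalize x i.succ = c
      fin_cases a <;> fin_cases b <;> fin_cases c <;> simp at ha ⊢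
    · rw [if_neg h1]
      by_cases h2 : j = i.succ
      · rw [if_pos h2, onQubit_gZ_mul_apply, hX]
        clear hX
        subst h2
        simp only [czSign, ← hb i.castSucc hne]
        generalize x i.succ = a at ha ⊢
        generalize y i.succ = b at ha ⊢
        generalize x i.castSucc = c
        fin_cases a <;> fin_cases b <;> fin_cases c <;> simp at ha ⊢
      · rw [if_neg h2]
        simp only [czSign, hb i.castSucc (Ne.symm h1), hb i.succ (Ne.symm h2), mul_comm]
  · rw [if_neg hxy] at hX
    split_ifs <;> simp only [onQubit_gZ_mul_apply, hX, mul_zero, zero_mul]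

theorem uCZ_mem {k : ℕ} (i : Fin k) : uCZ i ∈ Cliff (k + 1) := by
  refine mem_Cliff_of_conj (m := 1) ?_ (fun j => ?_) (fun j => ?_)
  · rw [pow_two, uCZ_mul_self]
  · rw [uCZ_conj_gX]
    split_ifs
    · exact mul_mem (onQubit_gZ_mem _) (onQubit_gX_mem j)
    · exact mul_mem (onQubit_gZ_mem _) (onQubit_gX_mem j)
    · exact onQubit_gX_mem j
  · rw [uCZ_conj_gZ]
    exact onQubit_gZ_mem j

theorem omegaI_mem (n : ℕ) : omegaI n ∈ Cliff n := by
  rw [Cliff, Subgroup.mem_normalizer_iff]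
  intro P
  have h : omegaI n * P * (omegaI n)⁻¹ = P := by rw [← omegaI_comm, mul_inv_cancel_right]
  rw [h]

/-- The group `⟨ω I⟩` of scalar matrices, as a subgroup of the Clifford group. -/
def scalars (n : ℕ) : Subgroup (Cliff n) := Subgroup.zpowers ⟨omegaI n, omegaI_mem n⟩

instance scalars_normal (n : ℕ) : (scalars n).Normal := by
  refine ⟨fun a ha g => ?_⟩
  have hc : Commute g (⟨omegaI n, omegaI_mem n⟩ : Cliff n) := Subtype.ext (omegaI_comm g.1)
  obtain ⟨r, rfl⟩ := Subgroup.mem_zpowers_iff.1 ha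
  rw [(hc.zpow_right r).eq, mul_inv_cancel_right]
  exact Subgroup.zpow_mem_zpowers _ r

/-- The `n`-qubit projective Clifford group `Cliff n / ⟨ω I⟩`. Its product is written from left to
right (circuit order), opposite to the order of matrix multiplication; hence `ᵐᵒᵖ`. -/
abbrev ProjCliff (n : ℕ) := (Cliff n ⧸ scalars n)ᵐᵒᵖ

/-- The class `[U]` of a Clifford operator. -/
def toProj {n : ℕ} (U : Cliff n) : ProjCliff n := MulOpposite.op (QuotientGroup.mk U)

/-! ### Generators; qubits are numbered from `0` -/

/-- The class of the Hadamard gate on the qubit `i`. -/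
def h {n : ℕ} (i : Fin n) : ProjCliff n := toProj ⟨onQubit gH i, onQubit_gH_mem i⟩

/-- The class of the phase gate on the qubit `i`. -/
def s {n : ℕ} (i : Fin n) : ProjCliff n := toProj ⟨onQubit gS i, onQubit_gS_mem i⟩

/-- The class of the controlled `Z` gate on the qubits `i`, `i + 1`. -/
def cz {k : ℕ} (i : Fin k) : ProjCliff (k + 1) := toProj ⟨uCZ i, uCZ_mem i⟩

/-- `M = h₂ Λ₁ s₂² h₂ h₁ s₁² h₂ Λ₁ h₂` (with qubits and gates numbered from `1` here). -/
def elemM (k : ℕ) : ProjCliff (k + 2) :=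
  h 1 * cz 0 * s 1 ^ 2 * h 1 * h 0 * s 0 ^ 2 * h 1 * cz 0 * h 1

/-- The inertia subgroup, given by generators (a dummy value for `n = 0`). -/
def IN : (n : ℕ) → Subgroup (ProjCliff n)
  | 0 => ⊥
  | 1 => Subgroup.closure {h 0, s 0 ^ 3 * h 0 * s 0 * h 0 * s 0}
  | 2 => Subgroup.closure {h 0, h 1, s 1, h 0 * s 0 ^ 2 * h 0, elemM 0}
  | k + 3 => Subgroup.closure
      ({g | ∃ i : Fin (k + 3), g = h i} ∪ {g | ∃ i : Fin (k + 3), i ≠ 0 ∧ g = s i} ∪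
        {elemM (k + 1)} ∪ {g | ∃ i : Fin (k + 2), i ≠ 0 ∧ g = cz i})

/-- The subgroup `F n` (a dummy value for `n = 0`). -/
def F : (n : ℕ) → Subgroup (ProjCliff n)
  | 0 => ⊥
  | 1 => Subgroup.closure {s 0 ^ 3 * h 0 * s 0 * h 0 * s 0}
  | 2 => Subgroup.closure {h 1, s 1, h 0 * s 0 ^ 2 * h 0, elemM 0}
  | k + 3 => Subgroup.closure
      ({g | ∃ i : Fin (k + 3), i ≠ 0 ∧ g = h i} ∪ {g | ∃ i : Fin (k + 3), i ≠ 0 ∧ g = s i} ∪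
        {elemM (k + 1)} ∪ {g | ∃ i : Fin (k + 2), i ≠ 0 ∧ g = cz i})

end

end QubitClifford

namespace QubitClifford

/-! ### Adjoining a normalizing involution to a finite subgroup -/

/-! The generators of `IN n` are those of `F n` together with the involution `h 0`. The theorem
therefore splits into three claims: `h 0` normalizes `F n`, `h 0` is not in `F n`, and `IN n` is
finite. Given these, `F n` and its coset by `h 0` exhaust `IN n`, so the index is two.

Normalization. For `n ≥ 2`, most generators act away from qubit 0 and commute with `h 0`. The
generator `elemM` is inverted by `h 0`, since the product of `elemM` and its conjugate is, up to
conjugation, the square of a word that is an involution (`controlled_word_sq`, `h_mul_elemM_mul_h`).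
For `n = 2` the generator `h 0 * s 0 ^ 2 * h 0` is sent to `s 0 ^ 2`, which is recovered inside `F
2` by `s_zero_sq_mem`. For `n = 1` the relation `s h s h s = h` turns the generator into `s ^ 2 *
h`, which `h` inverts.

Exclusion of `h 0`. Let the groups act on Pauli operators by conjugation. For `n = 1` and `n ≥ 3`,
`F n` fixes `XZ` on qubit 0, while `h 0` changes its sign (`h_notMem_of_fix`). For `n = 2` the class
of `X` on qubit 0 lies in `F 2` and also changes that sign. Instead, `F 2` preserves, up to phases,
the tetrad `X₀, Z₀X₁, Z₀X₁Z₁, Z₀Z₁`, and `h 0` sends `X₀` to `Z₀`, outside it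
(`h_notMem_of_preservesTetrad`).

Finiteness. The normalizer in the full unitary group contains every scalar of modulus one, so the
quotient by `⟨ωI⟩` is still infinite. All gates used have determinant a fourth root of unity, and
such Clifford operators form a finite group: they act on the finite Pauli group, and the kernel of
the action consists of scalars that are roots of unity of bounded order (`finite_Cliff_detFour`). -/

theorem index_two_of_involution {G : Type*} [Group G] {S : Set G} {t : G} (ht : t * t = 1)
    (hn : ∀ g ∈ S, t * g * t ∈ Subgroup.closure S) (hnot : t ∉ Subgroup.closure S)
    (hfin : Finite (Subgroup.closure (insert t S))) :
    Subgroup.closure S ≤ Subgroup.closure (insert t S) ∧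
      ((Subgroup.closure S).subgroupOf (Subgroup.closure (insert t S))).Normal ∧
      Finite (Subgroup.closure (insert t S)) ∧
      2 * Nat.card (Subgroup.closure S) = Nat.card (Subgroup.closure (insert t S)) := by
  have hle : Subgroup.closure S ≤ Subgroup.closure (insert t S) :=
    Subgroup.closure_mono (Set.subset_insert t S)
  have htinv : t⁻¹ = t := inv_eq_of_mul_eq_one_left ht
  have htm : t ∈ Subgroup.closure (insert t S) := Subgroup.subset_closure (Set.mem_insert t S)
  -- Conjugation by the involution `t` respects products and inverses, so the hypothesis on `S`
  -- extends to the closure.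
  have hconj : ∀ g ∈ Subgroup.closure S, t * g * t ∈ Subgroup.closure S := by
    intro g hg
    induction hg using Subgroup.closure_induction with
    | mem x hx => exact hn x hx
    | one => simp [ht]
    | mul x y _ _ hx hy =>
      have : t * (x * y) * t = t * x * t * (t * y * t) := by
        simp only [mul_assoc, ← mul_assoc t t, ht, one_mul]
      exact this ▸ mul_mem hx hy
    | inv x _ hx =>
      have : t * x⁻¹ * t = (t * x * t)⁻¹ := by simp [htinv, mul_assoc]
      exact this ▸ inv_mem hx
  -- At most two cosets: a factor `t` can be moved to the left through the closure of `S`, and two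
  -- such factors cancel.
  have hcase : ∀ g ∈ Subgroup.closure (insert t S),
      g ∈ Subgroup.closure S ∨ t * g ∈ Subgroup.closure S := by
    intro g hg
    induction hg using Subgroup.closure_induction with
    | mem x hx =>
      rcases hx with rfl | hx
      · exact Or.inr (by rw [ht]; exact one_mem _)
      · exact Or.inl (Subgroup.subset_closure hx)
    | one => exact Or.inl (one_mem _)
    | mul x y _ _ hx hy =>
      rcases hx with hx | hx <;> rcases hy with hy | hy
      · exact Or.inl (mul_mem hx hy)
      · refine Or.inr ?_
        have : t * (x * y) = t * x * t * (t * y) := by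
          simp only [mul_assoc, ← mul_assoc t t, ht, one_mul]
        exact this ▸ mul_mem (hconj x hx) hy
      · exact Or.inr (mul_assoc t x y ▸ mul_mem hx hy)
      · refine Or.inl ?_
        have : x * y = t * (t * x) * t * (t * y) := by
          simp only [mul_assoc, ← mul_assoc t t, ht, one_mul]
        exact this ▸ mul_mem (hconj _ hx) hy
    | inv x _ hx =>
      rcases hx with hx | hx
      · exact Or.inl (inv_mem hx)
      · refine Or.inr ?_
        have : t * x⁻¹ = t * (t * x)⁻¹ * t := by simp [htinv, mul_assoc, ht]
        exact this ▸ hconj _ (inv_mem hx)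
  have hindex : ((Subgroup.closure S).subgroupOf (Subgroup.closure (insert t S))).index = 2 := by
    rw [Subgroup.index_eq_two_iff']
    refine ⟨⟨t, htm⟩, fun ⟨b, hb⟩ => ?_⟩
    simp only [Subgroup.mem_subgroupOf, Subgroup.coe_mul]
    rcases hcase b hb with h | h
    · exact Or.inr ⟨h, fun h' => hnot ((Subgroup.mul_mem_cancel_right _ h).1 h')⟩
    · exact Or.inl ⟨h, fun h' => hnot ((Subgroup.mul_mem_cancel_right _ h').1 h)⟩
  refine ⟨hle, Subgroup.normal_of_index_eq_two hindex, hfin, ?_⟩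
  have hcard := Subgroup.index_mul_card
    ((Subgroup.closure S).subgroupOf (Subgroup.closure (insert t S)))
  rwa [hindex, Nat.card_congr (Subgroup.subgroupOfEquivOfLe hle).toEquiv] at hcard

/-! ### Unitary matrices over the Gaussian integers -/

/-- Unitary matrices whose entries are Gaussian integers. -/
def gaussianUnitary (ι : Type*) [Fintype ι] [DecidableEq ι] :
    Subgroup (Matrix.unitaryGroup ι ℂ) where
  carrier := {U | ∀ x y, (U : Matrix ι ι ℂ) x y ∈ GaussianInt.toComplex.range}
  mul_mem' := by
    intro U V hU hV x y
    rw [Submonoid.coe_mul, Matrix.mul_apply]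
    exact sum_mem fun z _ => mul_mem (hU x z) (hV z y)
  one_mem' := by
    intro x y
    rw [Submonoid.coe_one, Matrix.one_apply]
    split_ifs
    exacts [one_mem _, zero_mem _]
  inv_mem' := by
    intro U hU x y
    obtain ⟨z, hz⟩ := hU y x
    refine ⟨star z, ?_⟩
    rw [GaussianInt.toComplex_star, hz]
    rfl

theorem finite_gaussianInt_norm_le_one : {z : GaussianInt | ‖(z : ℂ)‖ ≤ 1}.Finite := by
  have hsub : {z : GaussianInt | ‖(z : ℂ)‖ ≤ 1} ⊆
      (fun p : ℤ × ℤ => (⟨p.1, p.2⟩ : GaussianInt)) '' (Set.Icc (-1) 1 ×ˢ Set.Icc (-1) 1) := by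
    intro z hz
    have hre := (Complex.abs_re_le_norm (z : ℂ)).trans hz
    have him := (Complex.abs_im_le_norm (z : ℂ)).trans hz
    rw [← GaussianInt.intCast_re, abs_le] at hre
    rw [← GaussianInt.intCast_im, abs_le] at him
    refine ⟨(z.re, z.im), ⟨⟨?_, ?_⟩, ⟨?_, ?_⟩⟩, rfl⟩
    exacts [by exact_mod_cast hre.1, by exact_mod_cast hre.2, by exact_mod_cast him.1,
      by exact_mod_cast him.2]
  exact (((Set.finite_Icc _ _).prod (Set.finite_Icc _ _)).image _).subset hsub

/-- Entries of a unitary matrix have norm at most one, and only finitely many Gaussian integers do.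
-/
instance gaussianUnitary_finite (ι : Type*) [Fintype ι] [DecidableEq ι] :
    Finite (gaussianUnitary ι) := by
  have := finite_gaussianInt_norm_le_one.image GaussianInt.toComplex
  have hfin : Finite (GaussianInt.toComplex '' {z : GaussianInt | ‖(z : ℂ)‖ ≤ 1}) := this
  refine Finite.of_injective (fun (U : gaussianUnitary ι) (x y : ι) =>
    (⟨(U.1 : Matrix ι ι ℂ) x y, ?_⟩ :
      GaussianInt.toComplex '' {z : GaussianInt | ‖(z : ℂ)‖ ≤ 1})) ?_
  · obtain ⟨z, hz⟩ := U.2 x y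
    refine ⟨z, ?_, hz⟩
    change ‖GaussianInt.toComplex z‖ ≤ 1
    rw [hz]
    exact entry_norm_bound_of_unitary U.1.2 x y
  · intro U V hUV
    refine Subtype.ext (Subtype.ext (Matrix.ext fun x y => ?_))
    exact congrArg Subtype.val (congrFun (congrFun hUV x) y)

theorem Pauli_le_gaussianUnitary (n : ℕ) : Pauli n ≤ gaussianUnitary (Fin n → Fin 2) := by
  have hite : ∀ (p : Prop) [Decidable p], (if p then (1 : ℂ) else 0) ∈
      GaussianInt.toComplex.range := by
    intro p _
    split_ifs
    exacts [one_mem _, zero_mem _]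
  rw [Pauli, Subgroup.closure_le]
  rintro P ((⟨i, rfl⟩ | ⟨i, rfl⟩) | rfl) x y
  · rw [onQubit_apply]
    refine mul_mem ?_ (hite _)
    generalize x i = a
    generalize y i = b
    fin_cases a <;> fin_cases b <;> simp only [gX, matX] <;>
      first | exact zero_mem _ | exact one_mem _
  · rw [onQubit_apply]
    refine mul_mem ?_ (hite _)
    generalize x i = a
    generalize y i = b
    fin_cases a <;> fin_cases b <;> simp only [gZ, matZ] <;>
      first | exact zero_mem _ | exact one_mem _ | exact neg_mem (one_mem _)
  · have h1 : ((omegaI n ^ 2 : UN n) : Matrix _ _ ℂ) x y =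
        Complex.I * if x = y then 1 else 0 := by
      simp [omegaI, pow_two, ← omega_sq, Matrix.one_apply]
    rw [h1]
    exact mul_mem ⟨⟨0, 1⟩, by simp [GaussianInt.toComplex_def]⟩ (hite _)

instance Pauli_finite (n : ℕ) : Finite (Pauli n) :=
  Finite.of_injective _ (Subgroup.inclusion_injective (Pauli_le_gaussianUnitary n))

/-! ### Operators commuting with all Pauli operators -/

/-- Comparing the `(x, y)` entries of both products, where the two `Z` signs differ, shows that the
entry equals its negative. -/
theorem apply_eq_zero_of_commute_gZ {n : ℕ} {U : UN n} {i : Fin n}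
    (hU : onQubit gZ i * U = U * onQubit gZ i) {x y : Fin n → Fin 2} (h : x i ≠ y i) :
    (U : Matrix _ _ ℂ) x y = 0 := by
  have h1 := congrArg (fun V : UN n => (V : Matrix _ _ ℂ) x y) hU
  have h2 : ((U * onQubit gZ i : UN n) : Matrix _ _ ℂ) x y =
      (U : Matrix _ _ ℂ) x y * (if y i = 1 then -1 else 1) := by
    rw [Submonoid.coe_mul, Matrix.mul_apply, Finset.sum_eq_single y]
    · rw [← mul_one (onQubit gZ i), onQubit_gZ_mul_apply]
      simp
    · intro z _ hz
      rw [← mul_one (onQubit gZ i), onQubit_gZ_mul_apply]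
      simp [Matrix.one_apply_ne hz]
    · simp
  simp only [onQubit_gZ_mul_apply, h2] at h1
  generalize x i = a at h h1
  generalize y i = b at h h1
  fin_cases a <;> fin_cases b <;> simp at h h1 ⊢ <;>
    first | linear_combination (1 / 2 : ℂ) * h1 | linear_combination (-1 / 2 : ℂ) * h1

/-- Let `x'` be `x` with bit `i` flipped. The `(x, x')` entry of `XU` is `U x' x'`, and that of `UX`
is `U x x`. -/
theorem apply_update_of_commute_gX {n : ℕ} {U : UN n} {i : Fin n}
    (hU : onQubit gX i * U = U * onQubit gX i) (x : Fin n → Fin 2) (b : Fin 2) :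
    (U : Matrix _ _ ℂ) (Function.update x i b) (Function.update x i b) =
      (U : Matrix _ _ ℂ) x x := by
  by_cases hb : b = x i
  · rw [hb, Function.update_eq_self]
  have hX : ∀ y z : Fin n → Fin 2, ((onQubit gX i : UN n) : Matrix _ _ ℂ) y z =
      if z = Function.update y i (1 - y i) then 1 else 0 := by
    intro y z
    rw [onQubit_apply]
    by_cases hz : ∀ j, j ≠ i → y j = z j
    · have : (z = Function.update y i (1 - y i)) ↔ z i = 1 - y i := by
        constructor
        · intro h; rw [h]; simp
        · intro h
          funext j
          by_cases hj : j = i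
          · subst hj; simp [h]
          · simp [hj, hz j hj]
      simp only [this, if_pos hz, mul_one]
      generalize y i = a
      generalize z i = c
      fin_cases a <;> fin_cases c <;> simp [gX, matX]
    · rw [if_neg hz, mul_zero, if_neg]
      intro h
      exact hz fun j hj => by rw [h]; simp [hj]
  have hb' : b = 1 - x i := by
    generalize x i = a at hb
    fin_cases a <;> fin_cases b <;> simp at hb ⊢
  have hxx : x = Function.update (Function.update x i (1 - x i)) i
      (1 - (Function.update x i (1 - x i)) i) := by simp
  have hsymm : ∀ z : Fin n → Fin 2, (Function.update x i (1 - x i) =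
      Function.update z i (1 - z i)) ↔ z = x := by
    intro z
    constructor
    · intro h
      funext j
      have hj := congrFun h j
      by_cases hji : j = i
      · subst hji
        simpa using hj.symm
      · simpa [hji] using hj.symm
    · rintro rfl; rfl
  have h1 := congrArg (fun V : UN n => (V : Matrix _ _ ℂ) x (Function.update x i (1 - x i))) hU
  simp only [Submonoid.coe_mul, Matrix.mul_apply, hX, hsymm] at h1
  simpa [hb'] using h1

/-- Commuting with every `Z` forces `U` to be diagonal; commuting with every `X` makes the diagonal
invariant under bit flips, hence constant. -/
theorem eq_smul_one_of_commute {n : ℕ} {U : UN n}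
    (hX : ∀ i, onQubit gX i * U = U * onQubit gX i)
    (hZ : ∀ i, onQubit gZ i * U = U * onQubit gZ i) :
    (U : Matrix (Fin n → Fin 2) (Fin n → Fin 2) ℂ) = ((U : Matrix (Fin n → Fin 2) (Fin n → Fin 2) ℂ) 0 0) • 1 := by
  -- The bit string `x` is reached from `0` by changing one bit at a time; `t` is the set of bits
  -- already changed.
  have hdiag : ∀ (x : Fin n → Fin 2) (t : Finset (Fin n)),
      (U : Matrix (Fin n → Fin 2) (Fin n → Fin 2) ℂ) (t.piecewise x 0) (t.piecewise x 0) =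
        (U : Matrix (Fin n → Fin 2) (Fin n → Fin 2) ℂ) 0 0 := by
    intro x t
    induction t using Finset.induction_on with
    | empty => simp
    | insert i t _ ih => rw [Finset.piecewise_insert, apply_update_of_commute_gX (hX i), ih]
  ext x y
  by_cases hxy : x = y
  · subst hxy
    simpa using hdiag x Finset.univ
  · obtain ⟨i, hi⟩ := Function.ne_iff.1 hxy
    rw [apply_eq_zero_of_commute_gZ (hZ i) hi]
    simp [Matrix.one_apply_ne hxy]

/-! ### Clifford operators of bounded determinant -/

/-- Unitary operators whose determinant is a fourth root of unity. -/
def detFour (n : ℕ) : Subgroup (UN n) where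
  carrier := {U | (U : Matrix (Fin n → Fin 2) (Fin n → Fin 2) ℂ).det ^ 4 = 1}
  mul_mem' := by
    intro U V hU hV
    simp only [Set.mem_ofPred_eq] at hU hV ⊢
    rw [Submonoid.coe_mul, Matrix.det_mul, mul_pow, hU, hV, mul_one]
  one_mem' := by simp
  inv_mem' := by
    intro U hU
    simp only [Set.mem_ofPred_eq] at hU ⊢
    have h : ((U⁻¹ * U : UN n) : Matrix (Fin n → Fin 2) (Fin n → Fin 2) ℂ).det ^ 4 = 1 := by simp
    rwa [Submonoid.coe_mul, Matrix.det_mul, mul_pow, hU, mul_one] at h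

/-- The matrices of `h`, `s` and `cz` have fourth power exactly `1`, which is how they satisfy the
determinant bound. -/
theorem mem_detFour_of_pow {n : ℕ} {U : UN n} (h : U ^ 4 = 1) : U ∈ detFour n := by
  change (U : Matrix (Fin n → Fin 2) (Fin n → Fin 2) ℂ).det ^ 4 = 1
  rw [← Matrix.det_pow, ← SubmonoidClass.coe_pow, h]
  simp

theorem finite_scalar_detFour (n : ℕ) :
    {U : UN n | U ∈ detFour n ∧ (U : Matrix (Fin n → Fin 2) (Fin n → Fin 2) ℂ) =
      ((U : Matrix (Fin n → Fin 2) (Fin n → Fin 2) ℂ) 0 0) • 1}.Finite := by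
  -- The determinant of `c • 1` is `c` to the dimension, so its fourth power being `1` makes `c` an
  -- `m`-th root of unity.
  set m := Fintype.card (Fin n → Fin 2) * 4 with hm
  have hmpos : 0 < m := by positivity
  have hroots : {c : ℂ | c ^ m = 1}.Finite := by
    refine ((Polynomial.nthRootsFinset m (1 : ℂ)).finite_toSet).subset fun c hc => ?_
    exact (Polynomial.mem_nthRootsFinset hmpos 1).2 hc
  refine Set.Finite.of_finite_image (f := fun U : UN n => (U : Matrix (Fin n → Fin 2) (Fin n → Fin 2) ℂ) 0 0)
    (hroots.subset ?_) ?_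
  · rintro _ ⟨U, ⟨hU, hc⟩, rfl⟩
    change (U : Matrix (Fin n → Fin 2) (Fin n → Fin 2) ℂ).det ^ 4 = 1 at hU
    rw [hc, Matrix.det_smul, Matrix.det_one, mul_one, ← pow_mul] at hU
    exact hU
  · rintro U ⟨_, hU⟩ V ⟨_, hV⟩ hUV
    refine Subtype.ext ?_
    rw [hU, hV]
    exact congrArg (fun c : ℂ => c • (1 : Matrix (Fin n → Fin 2) (Fin n → Fin 2) ℂ)) hUV

/-- The conjugation action maps this group to the finite group `MulAut (Pauli n)`. Its kernel
centralizes the Pauli group, so it consists of scalars with bounded determinant. A finite kernel and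
a finite image give a finite group. -/
theorem finite_Cliff_detFour (n : ℕ) : Finite ((detFour n).subgroupOf (Cliff n)) := by
  set K := (detFour n).subgroupOf (Cliff n)
  let f : K →* MulAut (Pauli n) := (Subgroup.normalizerMonoidHom (Pauli n)).comp K.subtype
  have : Finite (MulAut (Pauli n)) :=
    Finite.of_injective (fun e : MulAut (Pauli n) => (e : Pauli n → Pauli n))
      DFunLike.coe_injective
  have hker : Finite f.ker := by
    have := (finite_scalar_detFour n).to_subtype
    refine Finite.of_injective (β := {U : UN n | U ∈ detFour n ∧
      (U : Matrix (Fin n → Fin 2) (Fin n → Fin 2) ℂ) = ((U : Matrix (Fin n → Fin 2) (Fin n → Fin 2) ℂ) 0 0) • 1})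
      (fun U => ⟨U.1.1.1, U.1.2, ?_⟩) ?_
    · have hU : (U.1.1 : Cliff n) ∈ (Subgroup.normalizerMonoidHom (Pauli n)).ker := U.2
      rw [Subgroup.normalizerMonoidHom_ker] at hU
      have hc := Subgroup.mem_centralizer_iff.1 (Subgroup.mem_subgroupOf.1 hU)
      exact eq_smul_one_of_commute (fun i => hc _ (onQubit_gX_mem i))
        (fun i => hc _ (onQubit_gZ_mem i))
    · intro U V hUV
      have hval := congrArg Subtype.val hUV
      exact Subtype.ext (Subtype.ext (Subtype.ext hval))
  have hq : Finite (K ⧸ f.ker) :=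
    Finite.of_equiv _ (QuotientGroup.quotientKerEquivRange f).symm.toEquiv
  exact Finite.of_equiv _ (Subgroup.groupEquivQuotientProdSubgroup (s := f.ker)).symm

/-! ### Relations between the generators -/

theorem toProj_mul {n : ℕ} (U V : Cliff n) : toProj U * toProj V = toProj (V * U) := rfl

theorem toProj_one {n : ℕ} : toProj (1 : Cliff n) = 1 := rfl

theorem h_mul_self {n : ℕ} (i : Fin n) : h i * h i = 1 := by
  have he : (⟨onQubit gH i, onQubit_gH_mem i⟩ * ⟨onQubit gH i, onQubit_gH_mem i⟩ : Cliff n) = 1 := by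
    apply Subtype.ext
    change onQubit gH i * onQubit gH i = 1
    rw [onQubit_mul, ← pow_two, gH_sq, onQubit_one]
  rw [h, toProj_mul, he, toProj_one]

theorem toProj_pow {n : ℕ} (U : Cliff n) (m : ℕ) : toProj U ^ m = toProj (U ^ m) := rfl

theorem s_pow_four {n : ℕ} (i : Fin n) : s i ^ 4 = 1 := by
  have he : ((⟨onQubit gS i, onQubit_gS_mem i⟩ : Cliff n) ^ 4) = 1 := by
    apply Subtype.ext
    change onQubit gS i ^ 4 = 1
    rw [onQubit_pow, gS_pow, onQubit_one]
  rw [s, toProj_pow, he, toProj_one]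

theorem toProj_commute {n : ℕ} {U V : Cliff n} (hc : U.1 * V.1 = V.1 * U.1) :
    Commute (toProj U) (toProj V) := by
  have he : U * V = V * U := Subtype.ext hc
  change toProj U * toProj V = toProj V * toProj U
  rw [toProj_mul, toProj_mul, he]

theorem h_commute_h {n : ℕ} {i j : Fin n} (hij : i ≠ j) : Commute (h i) (h j) :=
  toProj_commute (onQubit_commute _ _ hij)

theorem h_commute_s {n : ℕ} {i j : Fin n} (hij : i ≠ j) : Commute (h i) (s j) :=
  toProj_commute (onQubit_commute _ _ hij)

theorem s_commute_s {n : ℕ} {i j : Fin n} (hij : i ≠ j) : Commute (s i) (s j) :=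
  toProj_commute (onQubit_commute _ _ hij)

theorem uCZ_commute_onQubit {k : ℕ} (U : U2) {i : Fin k} {j : Fin (k + 1)}
    (h1 : j ≠ i.castSucc) (h2 : j ≠ i.succ) : onQubit U j * uCZ i = uCZ i * onQubit U j := by
  apply Subtype.ext
  ext x y
  rw [uCZ_mul_apply, mul_uCZ_apply, onQubit_apply]
  by_cases hxy : ∀ l, l ≠ j → x l = y l
  · simp only [czSign, hxy _ h1.symm, hxy _ h2.symm, mul_comm]
  · simp [hxy]

theorem h_commute_cz {k : ℕ} {i : Fin k} {j : Fin (k + 1)}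
    (h1 : j ≠ i.castSucc) (h2 : j ≠ i.succ) : Commute (h j) (cz i) :=
  toProj_commute (uCZ_commute_onQubit gH h1 h2)

theorem onQubit_gS_apply {n : ℕ} (i : Fin n) (x y : Fin n → Fin 2) :
    ((onQubit gS i : UN n) : Matrix _ _ ℂ) x y =
      if x = y then (if x i = 1 then omega ^ 2 else 1) else 0 := by
  rw [onQubit_apply]
  by_cases hxy : x = y
  · subst hxy
    generalize x i = a
    fin_cases a <;> simp [gS, matS]
  · rw [if_neg hxy]
    by_cases hj : ∀ j, j ≠ i → x j = y j
    · have hi : x i ≠ y i := fun hi => hxy <| funext fun j => by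
        by_cases hji : j = i
        · rw [hji, hi]
        · exact hj j hji
      generalize x i = a at hi
      generalize y i = b at hi
      fin_cases a <;> fin_cases b <;> simp [gS, matS] at hi ⊢
    · rw [if_neg hj, mul_zero]

theorem s_commute_cz {k : ℕ} (i : Fin k) (j : Fin (k + 1)) : Commute (s j) (cz i) := by
  refine toProj_commute (Subtype.ext ?_)
  ext x y
  change ((onQubit gS j * uCZ i : UN (k + 1)) : Matrix _ _ ℂ) x y =
    ((uCZ i * onQubit gS j : UN (k + 1)) : Matrix _ _ ℂ) x y
  rw [uCZ_mul_apply, mul_uCZ_apply, onQubit_gS_apply]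
  split_ifs with hxy
  · rw [hxy, mul_comm]
  · rw [hxy, mul_comm]
  · simp

/-! ### The controlled `Z` as a block operator, and the inversion of `elemM` -/

/-- With a central idempotent `p` commuting with `z` and `c`, the word below is an involution. -/
theorem controlled_word_sq {R : Type*} [Ring R] {p z c L : R} (hp : p * p = p) (hpz : p * z = z * p)
    (hpc : p * c = c * p) (hz : z * z = 1) (hc : c * c = 1) (hL : L = p + (1 - p) * z) :
    (z * L * c * L * c) * (z * L * c * L * c) = 1 := by
  set q := 1 - p with hq
  have hqz : q * z = z * q := by rw [hq, sub_mul, mul_sub, hpz, one_mul, mul_one]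
  have hqc : q * c = c * q := by rw [hq, sub_mul, mul_sub, hpc, one_mul, mul_one]
  have hpq : p * q = 0 := by rw [hq, mul_sub, mul_one, hp, sub_self]
  have hqp : q * p = 0 := by rw [hq, sub_mul, one_mul, hp, sub_self]
  have hqq : q * q = q := by
    calc q * q = (1 - p) * q := rfl
      _ = q := by rw [sub_mul, hpq, one_mul, sub_zero]
  have h1 : p * L = p := by rw [hL, mul_add, ← mul_assoc, hp, hpq, zero_mul, add_zero]
  have h2 : q * L = z * q := by rw [hL, mul_add, ← mul_assoc, hqp, hqq, zero_add, hqz]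
  have h1' : L * p = p := by
    rw [hL, add_mul, mul_assoc, ← hpz, ← mul_assoc, hp, hqp, zero_mul, add_zero]
  have h2' : L * q = z * q := by
    rw [hL, add_mul, mul_assoc, ← hqz, ← mul_assoc, hqq, hpq, zero_add, hqz]
  have hpL : p * L = L * p := by rw [h1, h1']
  have hqL : q * L = L * q := by rw [h2, h2']
  set W := z * L * c * L * c with hW
  -- On the `p` block `L` is the identity, so `W` reduces to `z * c * c = z`.
  have hWp : W * p = z * p := by
    calc W * p = z * L * c * L * (c * p) := by rw [hW]; simp only [mul_assoc]
      _ = z * L * c * (L * p) * c := by rw [← hpc]; simp only [mul_assoc]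
      _ = z * L * (c * p) * c := by rw [h1']; simp only [mul_assoc]
      _ = z * (L * p) * (c * c) := by rw [← hpc]; simp only [mul_assoc]
      _ = z * p := by rw [h1', hc, mul_one]
  -- On the `q` block `L` is `z`, so `W` reduces to `z * z * c * z * c = c * z * c`, again an
  -- involution.
  have hWq : W * q = c * z * c * q := by
    calc W * q = z * L * c * L * (c * q) := by rw [hW]; simp only [mul_assoc]
      _ = z * L * c * (L * q) * c := by rw [← hqc]; simp only [mul_assoc]
      _ = z * L * c * (q * z) * c := by rw [h2', hqz]
      _ = z * L * (c * q) * z * c := by simp only [mul_assoc]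
      _ = z * (L * q) * c * z * c := by rw [← hqc]; simp only [mul_assoc]
      _ = z * z * (q * c) * z * c := by rw [h2']; simp only [mul_assoc]
      _ = c * (q * z) * c := by rw [hz, hqc]; simp only [mul_assoc, one_mul]
      _ = c * z * (q * c) := by rw [hqz]; simp only [mul_assoc]
      _ = c * z * c * q := by rw [hqc]; simp only [mul_assoc]
  have hzq : W * (c * z * c * q) = q := by
    have : c * z * c * q = q * (c * z * c) := by
      rw [mul_assoc, ← hqc, ← mul_assoc, mul_assoc c z q, ← hqz, ← mul_assoc, ← hqc]
      simp only [mul_assoc]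
    rw [this, ← mul_assoc, hWq, mul_assoc _ q, ← this]
    simp only [← mul_assoc]
    rw [mul_assoc (c * z) c c, hc, mul_one, mul_assoc c z z, hz, mul_one, hc, one_mul]
  have hzp : W * (z * p) = p := by
    rw [← hpz, ← mul_assoc, hWp, mul_assoc, hpz, ← mul_assoc, hz, one_mul]
  calc W * W = W * (W * p + W * q) := by rw [← mul_add, hq, add_sub_cancel, mul_one]
    _ = p + q := by rw [mul_add, hWp, hWq, hzp, hzq]
    _ = 1 := by rw [hq, add_sub_cancel]

theorem gS_sq : gS ^ 2 = gZ := by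
  apply Subtype.ext
  change matS ^ 2 = matZ
  ext a b
  rw [matS, omega_sq]
  fin_cases a <;> fin_cases b <;> simp [pow_succ, matZ]

theorem gZ_mul_self : gZ * gZ = 1 := by
  rw [← gS_sq, ← pow_add, gS_pow]

/-- The projection of the qubit `i` onto the basis state `0`. -/
noncomputable def projZero {n : ℕ} (i : Fin n) : Matrix (Fin n → Fin 2) (Fin n → Fin 2) ℂ :=
  Matrix.diagonal fun x => if x i = 0 then 1 else 0

theorem projZero_mul_onQubit {n : ℕ} (U : U2) {i j : Fin n} (hij : i ≠ j) :
    projZero i * ((onQubit U j : UN n) : Matrix _ _ ℂ) =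
      ((onQubit U j : UN n) : Matrix _ _ ℂ) * projZero i := by
  ext x y
  rw [projZero, Matrix.diagonal_mul, Matrix.mul_diagonal, onQubit_apply]
  by_cases hxy : ∀ l, l ≠ j → x l = y l
  · rw [hxy i hij, mul_comm]
  · simp [hxy]

theorem onQubit_gZ_eq_diagonal {n : ℕ} (i : Fin n) :
    ((onQubit gZ i : UN n) : Matrix (Fin n → Fin 2) (Fin n → Fin 2) ℂ) =
      Matrix.diagonal fun x => if x i = 1 then -1 else 1 := by
  ext x y
  rw [← mul_one (onQubit gZ i), onQubit_gZ_mul_apply, Submonoid.coe_one]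
  by_cases hxy : x = y
  · subst hxy; simp
  · simp [hxy]

/-- The gate is symmetric in its two qubits; taking `i.succ` as control and `i.castSucc` as target
puts it in the form required by `controlled_word_sq`. -/
theorem uCZ_eq_projZero {k : ℕ} (i : Fin k) :
    ((uCZ i : UN (k + 1)) : Matrix (Fin (k + 1) → Fin 2) (Fin (k + 1) → Fin 2) ℂ) =
      projZero i.succ + (1 - projZero i.succ) *
        ((onQubit gZ i.castSucc : UN (k + 1)) : Matrix _ _ ℂ) := by
  change onPair matCZ i = _
  rw [onPair_matCZ, projZero, onQubit_gZ_eq_diagonal, ← Matrix.diagonal_one,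
    Matrix.diagonal_sub, Matrix.diagonal_mul_diagonal, Matrix.diagonal_add]
  congr 1
  funext x
  simp only [czSign, Prod.mk.injEq]
  generalize x i.succ = a
  generalize x i.castSucc = b
  fin_cases a <;> fin_cases b <;> simp

theorem uCZ_word_sq {k : ℕ} (i : Fin k) :
    (onQubit gZ i.castSucc * uCZ i * onQubit gH i.castSucc * uCZ i * onQubit gH i.castSucc) *
      (onQubit gZ i.castSucc * uCZ i * onQubit gH i.castSucc * uCZ i * onQubit gH i.castSucc) =
        1 := by
  have hne : i.succ ≠ i.castSucc := (Fin.castSucc_lt_succ (i := i)).ne'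
  have hz : ((onQubit gZ i.castSucc : UN (k + 1)) :
      Matrix (Fin (k + 1) → Fin 2) (Fin (k + 1) → Fin 2) ℂ) *
      ((onQubit gZ i.castSucc : UN (k + 1)) : Matrix _ _ ℂ) = 1 := by
    rw [← Submonoid.coe_mul, onQubit_mul, gZ_mul_self, onQubit_one, Submonoid.coe_one]
  have hc : ((onQubit gH i.castSucc : UN (k + 1)) :
      Matrix (Fin (k + 1) → Fin 2) (Fin (k + 1) → Fin 2) ℂ) *
      ((onQubit gH i.castSucc : UN (k + 1)) : Matrix _ _ ℂ) = 1 := by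
    rw [← Submonoid.coe_mul, onQubit_mul, ← pow_two, gH_sq, onQubit_one, Submonoid.coe_one]
  have hp : (projZero i.succ * projZero i.succ : Matrix (Fin (k + 1) → Fin 2) _ ℂ) =
      projZero i.succ := by
    rw [projZero, Matrix.diagonal_mul_diagonal]
    congr 1
    funext x
    split_ifs <;> simp
  have key := controlled_word_sq hp (projZero_mul_onQubit gZ hne) (projZero_mul_onQubit gH hne)
    hz hc (uCZ_eq_projZero i)
  apply Subtype.ext
  simp only [Submonoid.coe_mul, Submonoid.coe_one]
  exact key

theorem s_sq {n : ℕ} (i : Fin n) (hm : onQubit gZ i ∈ Cliff n) :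
    s i ^ 2 = toProj ⟨onQubit gZ i, hm⟩ := by
  have he : (⟨onQubit gS i, onQubit_gS_mem i⟩ : Cliff n) ^ 2 = ⟨onQubit gZ i, hm⟩ := by
    apply Subtype.ext
    change onQubit gS i ^ 2 = onQubit gZ i
    rw [onQubit_pow, gS_sq]
  rw [s, toProj_pow, he]

theorem cz_word_sq {k : ℕ} (i : Fin k) :
    (h i.castSucc * cz i * h i.castSucc * cz i * s i.castSucc ^ 2) *
      (h i.castSucc * cz i * h i.castSucc * cz i * s i.castSucc ^ 2) = 1 := by
  have hm : onQubit gZ i.castSucc ∈ Cliff (k + 1) :=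
    Subgroup.le_normalizer (onQubit_gZ_mem _)
  rw [s_sq _ hm]
  simp only [h, cz, toProj_mul]
  rw [← toProj_one]
  refine congrArg toProj (Subtype.ext ?_)
  have hw := uCZ_word_sq i
  simp only [mul_assoc] at hw
  simp only [Subgroup.coe_mul, Subgroup.coe_one, mul_assoc]
  exact hw

/-- The letters stand for `a = h 1`, `b = h 0`, `l = cz 0`, `w = s 1 ^ 2`, `z = s 0 ^ 2`. The word
`elemM` is the conjugate by `a` of `w * (l * b * l * z)`. Multiplying its conjugate by `b` with
itself gives, inside `a`, the square of `w * (b * l * b * l * z)`, a product of two commuting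
involutions. -/
theorem word_mul_word_eq_one {G : Type*} [Group G] {a b l w z : G} (haa : a * a = 1)
    (hab : a * b = b * a) (haz : a * z = z * a) (hwb : w * b = b * w) (hwz : w * z = z * w)
    (hwl : w * l = l * w) (hww : w * w = 1) (hzl : z * l = l * z)
    (key : (b * l * b * l * z) * (b * l * b * l * z) = 1) :
    (b * (a * l * w * a * b * z * a * l * a) * b) * (a * l * w * a * b * z * a * l * a) = 1 := by
  have hN : a * l * w * a * b * z * a * l * a = a * (w * (l * b * l * z)) * a := by
    calc a * l * w * a * b * z * a * l * a = a * l * w * (a * b) * z * a * l * a := by group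
      _ = a * l * w * b * (a * z) * a * l * a := by rw [hab]; group
      _ = a * l * w * b * z * (a * a) * l * a := by rw [haz]; group
      _ = a * (l * w) * b * (z * l) * a := by rw [haa]; group
      _ = _ := by rw [← hwl, hzl]; group
  have hc : Commute w (b * l * b * l * z) :=
    ((((Commute.mul_right hwb hwl).mul_right hwb).mul_right hwl).mul_right hwz)
  rw [hN]
  calc b * (a * (w * (l * b * l * z)) * a) * b * (a * (w * (l * b * l * z)) * a)
      = b * a * (w * (l * b * l * z)) * (a * b) * a * (w * (l * b * l * z)) * a := by group
    _ = a * b * (w * (l * b * l * z)) * b * (a * a) * (w * (l * b * l * z)) * a := by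
        rw [hab]; group
    _ = a * (b * w) * (l * b * l * z) * (b * w) * (l * b * l * z) * a := by rw [haa]; group
    _ = a * (w * (b * l * b * l * z)) * (w * (b * l * b * l * z)) * a := by rw [← hwb]; group
    _ = a * (w * (b * l * b * l * z)) ^ 2 * a := by rw [pow_two]; group
    _ = 1 := by rw [hc.mul_pow, pow_two, pow_two, hww, one_mul, key, mul_one, haa]

/-- Conjugation by `h 0` inverts `elemM`. -/
theorem h_mul_elemM_mul_h (k : ℕ) : (h 0 * elemM k * h 0) * elemM k = 1 := by
  have h10 : (1 : Fin (k + 2)) ≠ 0 := by simp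
  have key := cz_word_sq (0 : Fin (k + 1))
  rw [Fin.castSucc_zero] at key
  have hM : elemM k = h 1 * cz 0 * s 1 ^ 2 * h 1 * h 0 * s 0 ^ 2 * h 1 * cz 0 * h 1 := rfl
  rw [hM]
  refine word_mul_word_eq_one (h_mul_self 1) (h_commute_h h10).eq
    ((h_commute_s h10).pow_right 2).eq ((h_commute_s h10.symm).pow_right 2).eq.symm
    ((s_commute_s h10).pow_pow 2 2).eq ((s_commute_cz 0 1).pow_left 2).eq ?_
    ((s_commute_cz 0 0).pow_left 2).eq key
  rw [← pow_add, s_pow_four]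

/-! ### Finiteness of the groups generated by gates -/

/-- The classes of the Clifford operators whose determinant is a fourth root of unity. -/
noncomputable def projDetFour (n : ℕ) : Subgroup (ProjCliff n) :=
  (((detFour n).subgroupOf (Cliff n)).map (QuotientGroup.mk' (scalars n))).op

instance projDetFour_finite (n : ℕ) : Finite (projDetFour n) := by
  have := finite_Cliff_detFour n
  have hmap : Finite (((detFour n).subgroupOf (Cliff n)).map (QuotientGroup.mk' (scalars n))) :=
    Set.Finite.image (QuotientGroup.mk' (scalars n))
      (s := ((detFour n).subgroupOf (Cliff n) : Set (Cliff n))) this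
  exact Finite.of_equiv _ (Subgroup.equivOp _)

theorem toProj_mem_projDetFour {n : ℕ} {U : Cliff n} (hU : U.1 ^ 4 = 1) :
    toProj U ∈ projDetFour n :=
  Subgroup.mem_op.2 ⟨U, mem_detFour_of_pow hU, rfl⟩

theorem h_mem_projDetFour {n : ℕ} (i : Fin n) : h i ∈ projDetFour n := by
  refine toProj_mem_projDetFour ?_
  change onQubit gH i ^ 4 = 1
  rw [onQubit_pow, show 4 = 2 * 2 from rfl, pow_mul, gH_sq, one_pow, onQubit_one]

theorem s_mem_projDetFour {n : ℕ} (i : Fin n) : s i ∈ projDetFour n := by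
  refine toProj_mem_projDetFour ?_
  change onQubit gS i ^ 4 = 1
  rw [onQubit_pow, gS_pow, onQubit_one]

theorem cz_mem_projDetFour {k : ℕ} (i : Fin k) : cz i ∈ projDetFour (k + 1) := by
  refine toProj_mem_projDetFour ?_
  change uCZ i ^ 4 = 1
  rw [show 4 = 2 * 2 from rfl, pow_mul, pow_two (uCZ i), uCZ_mul_self, one_pow]

theorem elemM_mem_projDetFour (k : ℕ) : elemM k ∈ projDetFour (k + 2) := by
  have h0 := h_mem_projDetFour (0 : Fin (k + 2))
  have h1 := h_mem_projDetFour (1 : Fin (k + 2))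
  have l := cz_mem_projDetFour (0 : Fin (k + 1))
  have z := pow_mem (s_mem_projDetFour (0 : Fin (k + 2))) 2
  have w := pow_mem (s_mem_projDetFour (1 : Fin (k + 2))) 2
  exact mul_mem (mul_mem (mul_mem (mul_mem (mul_mem (mul_mem (mul_mem (mul_mem h1 l) w) h1) h0) z)
    h1) l) h1

theorem finite_closure {n : ℕ} {S : Set (ProjCliff n)} (hS : ∀ g ∈ S, g ∈ projDetFour n) :
    Finite (Subgroup.closure S) :=
  Finite.of_injective _ (Subgroup.inclusion_injective ((Subgroup.closure_le _).2 hS))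

/-! ### The conjugation action on unitary operators -/

/-- The conjugation action, as a homomorphism into the opposite of the automorphism group. -/
noncomputable def conjHom (n : ℕ) : ProjCliff n →* (MulAut (UN n))ᵐᵒᵖ :=
  MonoidHom.op (QuotientGroup.lift (scalars n) (MulAut.conj.comp (Cliff n).subtype) (by
    intro U hU
    obtain ⟨r, rfl⟩ := Subgroup.mem_zpowers_iff.1 hU
    refine MulEquiv.ext fun P => ?_
    have hc : Commute P (omegaI n ^ r) := Commute.zpow_right (omegaI_comm P) r
    change omegaI n ^ r * P * (omegaI n ^ r)⁻¹ = P
    rw [← hc.eq, mul_inv_cancel_right]))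

/-- The automorphism `P ↦ U * P * U⁻¹` for the class of `U`. -/
noncomputable def act {n : ℕ} (g : ProjCliff n) : MulAut (UN n) := (conjHom n g).unop

theorem act_toProj {n : ℕ} (U : Cliff n) (P : UN n) : act (toProj U) P = U.1 * P * (U.1)⁻¹ := rfl

theorem act_one {n : ℕ} (P : UN n) : act (1 : ProjCliff n) P = P := by simp [act]

/-- Circuit order: the left factor acts first, so words can be evaluated from left to right. -/
theorem act_mul {n : ℕ} (a b : ProjCliff n) (P : UN n) : act (a * b) P = act b (act a P) := by
  simp [act]

theorem toProj_surjective (n : ℕ) : Function.Surjective (toProj : Cliff n → ProjCliff n) :=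
  MulOpposite.op_surjective.comp QuotientGroup.mk_surjective

theorem act_omegaI {n : ℕ} (g : ProjCliff n) : act g (omegaI n) = omegaI n := by
  obtain ⟨U, rfl⟩ := toProj_surjective n g
  rw [act_toProj, omegaI_comm, mul_inv_cancel_right]

theorem act_h_gX {n : ℕ} (i j : Fin n) :
    act (h i) (onQubit gX j) = if i = j then onQubit gZ j else onQubit gX j := by
  rw [h, act_toProj, onQubit_conj, gH_conj_gX]

theorem act_h_gZ {n : ℕ} (i j : Fin n) :
    act (h i) (onQubit gZ j) = if i = j then onQubit gX j else onQubit gZ j := by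
  rw [h, act_toProj, onQubit_conj, gH_conj_gZ]

theorem act_s_gX {n : ℕ} (i j : Fin n) : act (s i) (onQubit gX j) =
    if i = j then omegaI n ^ 2 * (onQubit gX j * onQubit gZ j) else onQubit gX j := by
  rw [s, act_toProj, onQubit_conj, onQubit_gS_conj_gX]

theorem act_s_gZ {n : ℕ} (i j : Fin n) : act (s i) (onQubit gZ j) = onQubit gZ j := by
  rw [s, act_toProj, onQubit_conj, gS_conj_gZ, ite_self]

theorem onQubit_gX_mul_self {n : ℕ} (i : Fin n) : onQubit gX i * onQubit gX i = 1 := by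
  have hX : gX * gX = 1 := by
    apply Subtype.ext
    ext a b
    fin_cases a <;> fin_cases b <;> simp [gX, matX]
  rw [onQubit_mul, hX, onQubit_one]

theorem onQubit_gZ_mul_self {n : ℕ} (i : Fin n) : onQubit gZ i * onQubit gZ i = 1 := by
  rw [onQubit_mul, gZ_mul_self, onQubit_one]

theorem omegaI_pow_apply {n : ℕ} (m : ℕ) (U : UN n) (x y : Fin n → Fin 2) :
    ((omegaI n ^ m * U : UN n) : Matrix _ _ ℂ) x y = omega ^ m * (U : Matrix _ _ ℂ) x y := by
  induction m with
  | zero => simp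
  | succ m ih =>
    have h1 : ((omegaI n * (omegaI n ^ m * U) : UN n) : Matrix _ _ ℂ) x y =
        omega * ((omegaI n ^ m * U : UN n) : Matrix _ _ ℂ) x y := by
      change ((omega • 1 : Matrix (Fin n → Fin 2) (Fin n → Fin 2) ℂ) *
        ((omegaI n ^ m * U : UN n) : Matrix (Fin n → Fin 2) (Fin n → Fin 2) ℂ)) x y = _
      rw [Matrix.smul_mul, Matrix.one_mul, Matrix.smul_apply, smul_eq_mul]
    rw [pow_succ', mul_assoc, h1, ih, pow_succ', mul_assoc]

theorem omega_pow_four : omega ^ 4 = -1 := by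
  rw [show 4 = 2 * 2 from rfl, pow_mul, omega_sq, Complex.I_sq]

/-- The sign `-1` is written `omegaI n ^ 4`, so that it stays inside the unitary group and is fixed
by every `act g`. -/
theorem onQubit_gZ_mul_gX {n : ℕ} (i : Fin n) :
    onQubit gZ i * onQubit gX i = omegaI n ^ 4 * (onQubit gX i * onQubit gZ i) := by
  apply Subtype.ext
  ext x y
  rw [omegaI_pow_apply, omega_pow_four, onQubit_mul, onQubit_mul, onQubit_apply, onQubit_apply,
    ← mul_assoc]
  congr 1
  generalize x i = a
  generalize y i = b
  fin_cases a <;> fin_cases b <;> simp [gX, gZ, matX, matZ]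

theorem omegaI_pow_eight (n : ℕ) : omegaI n ^ 4 * omegaI n ^ 4 = 1 := by
  apply Subtype.ext
  ext x y
  rw [omegaI_pow_apply, ← mul_one (omegaI n ^ 4), omegaI_pow_apply, omega_pow_four]
  simp

theorem act_s_sq_gX {n : ℕ} (i j : Fin n) : act (s i ^ 2) (onQubit gX j) =
    if i = j then omegaI n ^ 4 * onQubit gX j else onQubit gX j := by
  rw [pow_two, act_mul, act_s_gX]
  split_ifs with hij
  · subst hij
    rw [map_mul, map_mul, map_pow, act_omegaI, act_s_gX, act_s_gZ, if_pos rfl]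
    rw [mul_assoc (omegaI n ^ 2) (_ * _), mul_assoc (onQubit gX i), onQubit_gZ_mul_self, mul_one,
      ← mul_assoc, ← pow_add]
  · rw [act_s_gX, if_neg hij]

theorem act_s_sq_gZ {n : ℕ} (i j : Fin n) : act (s i ^ 2) (onQubit gZ j) = onQubit gZ j := by
  rw [pow_two, act_mul, act_s_gZ, act_s_gZ]

theorem act_cz_gX {k : ℕ} (i : Fin k) (j : Fin (k + 1)) : act (cz i) (onQubit gX j) =
    if j = i.castSucc then onQubit gZ i.succ * onQubit gX j
    else if j = i.succ then onQubit gZ i.castSucc * onQubit gX j else onQubit gX j := by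
  rw [cz, act_toProj, uCZ_conj_gX]

theorem act_cz_gZ {k : ℕ} (i : Fin k) (j : Fin (k + 1)) :
    act (cz i) (onQubit gZ j) = onQubit gZ j := by
  rw [cz, act_toProj, uCZ_conj_gZ]

theorem gZ_mul_gX_ne {n : ℕ} (i : Fin n) :
    onQubit gZ i * onQubit gX i ≠ onQubit gX i * onQubit gZ i := by
  intro hc
  rw [onQubit_gZ_mul_gX] at hc
  have h1 : omegaI n ^ 4 = 1 := mul_eq_right.1 hc
  have h2 := omegaI_pow_apply 4 (1 : UN n) 0 0
  rw [h1, omega_pow_four] at h2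
  norm_num at h2

/-! ### Images of the Pauli generators of the first two qubits under `elemM` -/

theorem act_elemM_gX_zero (k : ℕ) :
    act (elemM k) (onQubit gX 0) = onQubit gX 1 * onQubit gZ 0 := by
  simp [elemM, act_mul, act_h_gX, act_h_gZ, act_s_sq_gX, act_s_sq_gZ, act_cz_gX, act_cz_gZ,
    -map_pow]

theorem act_elemM_gZ_zero (k : ℕ) :
    act (elemM k) (onQubit gZ 0) = omegaI _ ^ 4 * (onQubit gX 1 * onQubit gX 0) := by
  simp [elemM, act_mul, act_h_gX, act_h_gZ, act_s_sq_gX, act_s_sq_gZ, act_cz_gX, act_cz_gZ,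
    act_omegaI]

theorem act_elemM_gX_one (k : ℕ) : act (elemM k) (onQubit gX 1) = onQubit gX 1 := by
  simp [elemM, act_mul, act_h_gX, act_h_gZ, act_s_sq_gX, act_s_sq_gZ, act_cz_gZ]

theorem omegaI_pow_comm {n : ℕ} (U : UN n) (m : ℕ) : U * omegaI n ^ m = omegaI n ^ m * U :=
  Commute.pow_right (omegaI_comm U) m

theorem act_elemM_gZ_one (k : ℕ) : act (elemM k) (onQubit gZ 1) =
    onQubit gX 1 * onQubit gX 0 * (onQubit gZ 0 * onQubit gZ 1) := by
  have h1 : act (elemM k) (onQubit gZ 1) = omegaI (k + 2) ^ 4 * (onQubit gX 1 * onQubit gX 0) *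
      (omegaI (k + 2) ^ 4 * (onQubit gZ 0 * onQubit gZ 1)) := by
    simp [elemM, act_mul, act_h_gX, act_h_gZ, act_s_sq_gX, act_s_sq_gZ, act_cz_gX, act_omegaI]
  rw [h1, ← mul_assoc (_ * _) (omegaI _ ^ 4), omegaI_pow_comm, ← mul_assoc (omegaI _ ^ 4),
    omegaI_pow_eight, one_mul]

/-! ### The element `h 0` is not in `F n` -/

theorem act_elemM_fix (k : ℕ) : act (elemM k) (onQubit gX 0 * onQubit gZ 0) =
    onQubit gX 0 * onQubit gZ 0 := by
  have h10 : (1 : Fin (k + 2)) ≠ 0 := by simp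
  have hXZ : onQubit gX 1 * onQubit gZ 0 = (onQubit gZ 0 * onQubit gX 1 : UN (k + 2)) :=
    onQubit_commute _ _ h10
  rw [map_mul, act_elemM_gX_zero, act_elemM_gZ_zero, ← mul_assoc, omegaI_pow_comm, mul_assoc,
    hXZ, mul_assoc, ← mul_assoc (onQubit gX 1), onQubit_gX_mul_self, one_mul, onQubit_gZ_mul_gX,
    ← mul_assoc, omegaI_pow_eight, one_mul]

/-- The stabilizer of `XZ` is a subgroup, and `h i` is not in it: it turns `XZ` into `ZX`, which
differs by a sign. -/
theorem h_notMem_of_fix {n : ℕ} {S : Set (ProjCliff n)} (i : Fin n)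
    (hS : ∀ g ∈ S, act g (onQubit gX i * onQubit gZ i) = onQubit gX i * onQubit gZ i) :
    h i ∉ Subgroup.closure S := by
  have hall : ∀ g ∈ Subgroup.closure S,
      act g (onQubit gX i * onQubit gZ i) = onQubit gX i * onQubit gZ i := by
    intro g hg
    induction hg using Subgroup.closure_induction with
    | mem x hx => exact hS x hx
    | one => exact act_one _
    | mul x y _ _ hx hy => rw [act_mul, hx, hy]
    | inv x _ hx =>
      nth_rw 1 [← hx]
      rw [← act_mul, mul_inv_cancel, act_one]
  intro hmem
  have h1 := hall _ hmem
  rw [map_mul, act_h_gX, act_h_gZ, if_pos rfl, if_pos rfl] at h1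
  exact gZ_mul_gX_ne i h1

/-! ### The tetrad invariant used for two qubits -/

/-- Up to a power of `ω`, one of four pairwise anticommuting Pauli operators on the first two
qubits. -/
def IsTetrad {k : ℕ} (P : UN (k + 2)) : Prop :=
  ∃ m : ℕ, P = omegaI _ ^ m * onQubit gX 0 ∨ P = omegaI _ ^ m * (onQubit gZ 0 * onQubit gX 1) ∨
    P = omegaI _ ^ m * (onQubit gZ 0 * (onQubit gX 1 * onQubit gZ 1)) ∨
    P = omegaI _ ^ m * (onQubit gZ 0 * onQubit gZ 1)

theorem IsTetrad.omegaI_pow_mul {k : ℕ} {P : UN (k + 2)} (hP : IsTetrad P) (m : ℕ) :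
    IsTetrad (omegaI _ ^ m * P) := by
  obtain ⟨l, h⟩ := hP
  refine ⟨m + l, ?_⟩
  simpa only [pow_add, mul_assoc, mul_right_inj] using h

/-- The elements that preserve the tetrad up to powers of `ω`. -/
def PreservesTetrad {k : ℕ} (g : ProjCliff (k + 2)) : Prop :=
  ∀ P : UN (k + 2), IsTetrad P → IsTetrad (act g P)

theorem PreservesTetrad.mul {k : ℕ} {a b : ProjCliff (k + 2)} (ha : PreservesTetrad a)
    (hb : PreservesTetrad b) : PreservesTetrad (a * b) := fun P hP => by
  rw [act_mul]
  exact hb _ (ha _ hP)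

theorem preservesTetrad_one (k : ℕ) : PreservesTetrad (1 : ProjCliff (k + 2)) := fun P hP => by
  rwa [act_one]

theorem PreservesTetrad.pow {k : ℕ} {a : ProjCliff (k + 2)} (ha : PreservesTetrad a) (m : ℕ) :
    PreservesTetrad (a ^ m) := by
  induction m with
  | zero => rw [pow_zero]; exact preservesTetrad_one k
  | succ m ih => rw [pow_succ]; exact ih.mul ha

/-- Since `act g` is multiplicative and fixes `ωI`, it suffices to test one representative of each
of the four classes, computed from the images of the generators. -/
theorem preservesTetrad_of {k : ℕ} {g : ProjCliff (k + 2)}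
    (h1 : IsTetrad (act g (onQubit gX 0)))
    (h2 : IsTetrad (act g (onQubit gZ 0) * act g (onQubit gX 1)))
    (h3 : IsTetrad (act g (onQubit gZ 0) * (act g (onQubit gX 1) * act g (onQubit gZ 1))))
    (h4 : IsTetrad (act g (onQubit gZ 0) * act g (onQubit gZ 1))) : PreservesTetrad g := by
  rintro P ⟨m, rfl | rfl | rfl | rfl⟩ <;>
    simp only [map_mul, map_pow, act_omegaI] <;> apply IsTetrad.omegaI_pow_mul <;> assumption

theorem isTetrad_X (k : ℕ) : IsTetrad (onQubit gX 0 : UN (k + 2)) := ⟨0, by simp⟩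

theorem isTetrad_ZX (k : ℕ) : IsTetrad (onQubit gZ 0 * onQubit gX 1 : UN (k + 2)) := ⟨0, by simp⟩

theorem isTetrad_ZXZ (k : ℕ) :
    IsTetrad (onQubit gZ 0 * (onQubit gX 1 * onQubit gZ 1) : UN (k + 2)) := ⟨0, by simp⟩

theorem isTetrad_ZZ (k : ℕ) : IsTetrad (onQubit gZ 0 * onQubit gZ 1 : UN (k + 2)) := ⟨0, by simp⟩

theorem mul_omegaI_pow_mul {n : ℕ} (m : ℕ) (U V : UN n) :
    U * (omegaI n ^ m * V) = omegaI n ^ m * (U * V) := by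
  rw [← mul_assoc, omegaI_pow_comm, mul_assoc]

theorem preservesTetrad_h_one (k : ℕ) : PreservesTetrad (h (1 : Fin (k + 2))) := by
  have h10 : (1 : Fin (k + 2)) ≠ 0 := by simp
  refine preservesTetrad_of ?_ ?_ ?_ ?_ <;>
    simp only [act_h_gX, act_h_gZ, if_neg h10, if_pos]
  · exact isTetrad_X k
  · exact isTetrad_ZZ k
  · rw [onQubit_gZ_mul_gX, mul_omegaI_pow_mul]
    exact (isTetrad_ZXZ k).omegaI_pow_mul 4
  · exact isTetrad_ZX k

theorem preservesTetrad_s_one (k : ℕ) : PreservesTetrad (s (1 : Fin (k + 2))) := by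
  have h10 : (1 : Fin (k + 2)) ≠ 0 := by simp
  refine preservesTetrad_of ?_ ?_ ?_ ?_ <;>
    simp only [act_s_gX, act_s_gZ, if_neg h10, if_pos]
  · exact isTetrad_X k
  · rw [mul_omegaI_pow_mul]
    exact (isTetrad_ZXZ k).omegaI_pow_mul 2
  · rw [mul_assoc, mul_assoc, onQubit_gZ_mul_self, mul_one, mul_omegaI_pow_mul]
    exact (isTetrad_ZX k).omegaI_pow_mul 2
  · exact isTetrad_ZZ k

theorem preservesTetrad_x_zero (k : ℕ) :
    PreservesTetrad (h (0 : Fin (k + 2)) * s 0 ^ 2 * h 0) := by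
  have h01 : (0 : Fin (k + 2)) ≠ 1 := by simp
  refine preservesTetrad_of ?_ ?_ ?_ ?_ <;>
    simp only [act_mul, act_h_gX, act_h_gZ, act_s_sq_gX, act_s_sq_gZ, if_neg h01, if_pos,
      map_mul, map_pow, act_omegaI, mul_assoc]
  · exact isTetrad_X k
  · exact (isTetrad_ZX k).omegaI_pow_mul 4
  · exact (isTetrad_ZXZ k).omegaI_pow_mul 4
  · exact (isTetrad_ZZ k).omegaI_pow_mul 4

theorem preservesTetrad_elemM (k : ℕ) : PreservesTetrad (elemM k) := by
  have h10 : (1 : Fin (k + 2)) ≠ 0 := by simp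
  have hXX : onQubit gX 1 * onQubit gX 0 = (onQubit gX 0 * onQubit gX 1 : UN (k + 2)) :=
    onQubit_commute _ _ h10
  have hXZ : onQubit gX 1 * onQubit gZ 0 = (onQubit gZ 0 * onQubit gX 1 : UN (k + 2)) :=
    onQubit_commute _ _ h10
  have hx : ∀ (i : Fin (k + 2)) (U : UN (k + 2)), onQubit gX i * (onQubit gX i * U) = U :=
    fun i U => by rw [← mul_assoc, onQubit_gX_mul_self, one_mul]
  have hxx : ∀ U : UN (k + 2), onQubit gX 1 * (onQubit gX 0 * U) =
      onQubit gX 0 * (onQubit gX 1 * U) := fun U => by rw [← mul_assoc, hXX, mul_assoc]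
  have hxz : ∀ U : UN (k + 2), onQubit gX 1 * (onQubit gZ 0 * U) =
      onQubit gZ 0 * (onQubit gX 1 * U) := fun U => by rw [← mul_assoc, hXZ, mul_assoc]
  refine preservesTetrad_of ?_ ?_ ?_ ?_ <;>
    simp only [act_elemM_gX_zero, act_elemM_gZ_zero, act_elemM_gX_one, act_elemM_gZ_one,
      mul_assoc, hXX, hXZ, hx, hxx, hxz, onQubit_gX_mul_self, mul_one]
  · exact isTetrad_ZX k
  · exact (isTetrad_X k).omegaI_pow_mul 4
  · exact (isTetrad_ZXZ k).omegaI_pow_mul 4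
  · exact (isTetrad_ZZ k).omegaI_pow_mul 4

theorem commute_of_omegaI_pow_mul_eq_one {n : ℕ} {m : ℕ} {U : UN n} (hU : omegaI n ^ m * U = 1)
    (V : UN n) : U * V = V * U := by
  have hU' : U = (omegaI n ^ m)⁻¹ := (inv_eq_of_mul_eq_one_right hU).symm
  rw [hU']
  exact ((Commute.pow_right (omegaI_comm V) m).inv_right).eq.symm

theorem not_isTetrad_gZ (k : ℕ) : ¬ IsTetrad (onQubit gZ 0 : UN (k + 2)) := by
  -- Cancelling `Z₀` would make a nontrivial Pauli operator on qubit 1 scalar, hence central,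
  -- although it anticommutes with some other Pauli operator there.
  have hcancel : ∀ (m : ℕ) (U : UN (k + 2)), onQubit gZ 0 = omegaI _ ^ m * (onQubit gZ 0 * U) →
      ∀ V, U * V = V * U := by
    intro m U hU
    refine commute_of_omegaI_pow_mul_eq_one (m := m) ?_
    rw [← mul_omegaI_pow_mul] at hU
    exact (mul_eq_left.1 hU.symm)
  rintro ⟨m, hm | hm | hm | hm⟩
  · refine gZ_mul_gX_ne (0 : Fin (k + 2)) ?_
    rw [hm, mul_omegaI_pow_mul, mul_assoc]
  · exact gZ_mul_gX_ne (1 : Fin (k + 2)) (hcancel m _ hm _).symm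
  · have h1 := hcancel m _ hm (onQubit gX 1)
    rw [mul_assoc] at h1
    exact gZ_mul_gX_ne (1 : Fin (k + 2)) (mul_left_cancel h1)
  · exact gZ_mul_gX_ne (1 : Fin (k + 2)) (hcancel m _ hm _)

theorem h_notMem_of_preservesTetrad {k : ℕ} {S : Set (ProjCliff (k + 2))}
    (hfin : Finite (Subgroup.closure S)) (hS : ∀ g ∈ S, PreservesTetrad g) :
    h 0 ∉ Subgroup.closure S := by
  have hall : ∀ g ∈ Subgroup.closure S, PreservesTetrad g := by
    intro g hg
    induction hg using Subgroup.closure_induction with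
    | mem x hx => exact hS x hx
    | one => exact preservesTetrad_one k
    | mul x y _ _ hx hy => exact hx.mul hy
    | inv x hxm hx =>
      -- `PreservesTetrad` only asserts that the tetrad is mapped into itself, which does not pass
      -- formally to inverses; in a finite group the inverse is a positive or zeroth power.
      have hpow : x ^ (Nat.card (Subgroup.closure S) - 1 + 1) = 1 := by
        rw [Nat.sub_add_cancel Nat.card_pos]
        exact congrArg Subtype.val (pow_card_eq_one' (x := (⟨x, hxm⟩ : Subgroup.closure S)))
      have hinv : x⁻¹ = x ^ (Nat.card (Subgroup.closure S) - 1) := by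
        rw [inv_eq_iff_mul_eq_one, ← pow_succ', hpow]
      rw [hinv]
      exact hx.pow _
  intro hmem
  have h1 := hall _ hmem _ (isTetrad_X k)
  rw [act_h_gX, if_pos rfl] at h1
  exact not_isTetrad_gZ k h1

/-! ### The three cases -/

/-! ### The relation `SHSHS = ωH` and membership of `s 0 ^ 2` in `F 2` -/

theorem omega_eq : omega = ((1 / Real.sqrt 2 : ℝ) : ℂ) * (1 + Complex.I) := by
  have h2 : Real.sqrt 2 / 2 = 1 / Real.sqrt 2 := Real.sqrt_div_self'.symm ▸ rfl
  have h1 : (Real.pi * Complex.I / 4 : ℂ) = ((Real.pi / 4 : ℝ) : ℂ) * Complex.I := by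
    push_cast
    ring
  rw [omega, h1, Complex.exp_mul_I, ← Complex.ofReal_cos, ← Complex.ofReal_sin,
    Real.cos_pi_div_four, Real.sin_pi_div_four, h2]
  ring

theorem gS_mul_gH_word : ((gS * gH * gS * gH * gS : U2) : Matrix (Fin 2) (Fin 2) ℂ) =
    omega • (gH : Matrix (Fin 2) (Fin 2) ℂ) := by
  change matS * matH * matS * matH * matS = omega • matH
  have hI := Complex.I_mul_I
  rw [matS, omega_sq, omega_eq, matH]
  -- Both sides carry the same factor `c ^ 2`, one `c` on the right coming from `ω`, so the value of
  -- `c` is irrelevant and only `I * I = -1` is needed.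
  generalize ((1 / Real.sqrt 2 : ℝ) : ℂ) = c
  ext a b
  fin_cases a <;> fin_cases b <;>
    simp [Matrix.mul_apply, Fin.sum_univ_two] <;> ring_nf <;> simp <;> ring

theorem s_mul_h_word {n : ℕ} (i : Fin n) : s i * h i * s i * h i * s i = h i := by
  simp only [s, h, toProj_mul]
  refine MulOpposite.unop_injective (QuotientGroup.eq.2 ?_)
  -- The quotient of the two representatives is `(SHSHS)⁻¹ H = (ωI)⁻¹`.
  refine Subgroup.mem_zpowers_iff.2 ⟨-1, ?_⟩
  rw [zpow_neg_one, inv_eq_iff_eq_inv, mul_inv_rev, inv_inv, eq_inv_mul_iff_mul_eq]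
  apply Subtype.ext
  change onQubit gH i * omegaI n = onQubit gS i * (onQubit gH i * (onQubit gS i *
    (onQubit gH i * onQubit gS i)))
  simp only [onQubit_mul, ← mul_assoc]
  apply Subtype.ext
  ext x y
  rw [omegaI_comm, ← pow_one (omegaI n), omegaI_pow_apply, onQubit_apply, onQubit_apply,
    gS_mul_gH_word, pow_one, Matrix.smul_apply, smul_eq_mul, mul_assoc]

/-- In the opposite group `g⁻¹ * [P] * g` is the class of `U P U⁻¹`, so a computation on Pauli
operators becomes a relation between classes. -/
theorem toProj_act {n : ℕ} (g : ProjCliff n) {P Q : UN n} (hP : P ∈ Cliff n) (hQ : Q ∈ Cliff n)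
    (hg : act g P = Q) : g⁻¹ * toProj ⟨P, hP⟩ * g = toProj ⟨Q, hQ⟩ := by
  obtain ⟨U, rfl⟩ := toProj_surjective n g
  have he : U * ⟨P, hP⟩ * U⁻¹ = ⟨Q, hQ⟩ := Subtype.ext hg
  rw [← he, mul_assoc]
  rfl

/-- The class of `X₀` is `h 0 * s 0 ^ 2 * h 0`. Conjugation by `elemM 0` and then `h 1` carries `X₀`
to `X₁Z₀` and then to `Z₁Z₀`, whose class is `s 0 ^ 2 * s 1 ^ 2`; the factor `s 1 ^ 2` is removed.
-/
theorem s_zero_sq_mem {S : Set (ProjCliff 2)} (hh : h 1 ∈ Subgroup.closure S)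
    (hs : s 1 ∈ Subgroup.closure S) (hx : h 0 * s 0 ^ 2 * h 0 ∈ Subgroup.closure S)
    (hM : elemM 0 ∈ Subgroup.closure S) : s 0 ^ 2 ∈ Subgroup.closure S := by
  have hZ : ∀ i : Fin 2, onQubit gZ i ∈ Cliff 2 := fun i =>
    Subgroup.le_normalizer (onQubit_gZ_mem i)
  have hact : act (h 0 * elemM 0 * h 1 : ProjCliff 2) (onQubit gZ 0) =
      onQubit gZ 1 * onQubit gZ 0 := by
    rw [act_mul, act_mul, act_h_gZ, if_pos rfl]
    have := act_elemM_gX_zero 0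
    rw [this, map_mul, act_h_gX, act_h_gZ]
    simp
  have h1 := toProj_act _ (hZ 0) (mul_mem (hZ 1) (hZ 0)) hact
  have h2 : toProj ⟨onQubit gZ 1 * onQubit gZ 0, mul_mem (hZ 1) (hZ 0)⟩ =
      toProj ⟨onQubit gZ 0, hZ 0⟩ * toProj ⟨onQubit gZ 1, hZ 1⟩ := rfl
  rw [h2, ← s_sq, ← s_sq] at h1
  have h3 : (s 0 ^ 2 : ProjCliff 2) =
      (h 1 : ProjCliff 2)⁻¹ * (elemM 0 : ProjCliff 2)⁻¹ * (h 0 * s 0 ^ 2 * h 0) * elemM 0 * h 1 * (s 1 ^ 2 : ProjCliff 2)⁻¹ := by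
    rw [eq_mul_inv_iff_mul_eq, ← h1, mul_inv_rev, mul_inv_rev,
      inv_eq_of_mul_eq_one_left (h_mul_self (0 : Fin 2))]
    group
  rw [h3]
  exact mul_mem (mul_mem (mul_mem (mul_mem (mul_mem (inv_mem hh) (inv_mem hM)) hx) hM) hh)
    (inv_mem (pow_mem hs 2))

theorem h_mul_mul_h_of_commute {n : ℕ} {i : Fin n} {g : ProjCliff n} (hc : Commute (h i) g) :
    h i * g * h i = g := by
  rw [hc.eq, mul_assoc, h_mul_self, mul_one]

theorem h_mul_elemM_mul_h_eq (k : ℕ) :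
    (h 0 * elemM k * h 0 : ProjCliff (k + 2)) = (elemM k : ProjCliff (k + 2))⁻¹ :=
  eq_inv_of_mul_eq_one_left (h_mul_elemM_mul_h k)

theorem IN_add_three (k : ℕ) : IN (k + 3) = Subgroup.closure (insert (h 0)
    ({g | ∃ i : Fin (k + 3), i ≠ 0 ∧ g = h i} ∪ {g | ∃ i : Fin (k + 3), i ≠ 0 ∧ g = s i} ∪
        {elemM (k + 1)} ∪ {g | ∃ i : Fin (k + 2), i ≠ 0 ∧ g = cz i})) := by
  have hset : {g | ∃ i : Fin (k + 3), g = h i} =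
      insert (h 0) {g | ∃ i : Fin (k + 3), i ≠ 0 ∧ g = h i} := by
    ext g
    constructor
    · rintro ⟨i, rfl⟩
      by_cases hi : i = 0
      · exact Or.inl (by rw [hi])
      · exact Or.inr ⟨i, hi, rfl⟩
    · rintro (rfl | ⟨i, _, rfl⟩)
      exacts [⟨0, rfl⟩, ⟨i, rfl⟩]
  rw [IN, hset, Set.insert_union, Set.insert_union, Set.insert_union]

/-! ### Verification of normalization, exclusion and finiteness for each `n` -/

theorem F_one_index_two : F 1 ≤ IN 1 ∧ ((F 1).subgroupOf (IN 1)).Normal ∧ Finite (IN 1) ∧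
    2 * Nat.card (F 1) = Nat.card (IN 1) := by
  -- One factor of `s 0 ^ 3` is absorbed by `s h s h s = h`, leaving `s 0 ^ 2 * h 0`.
  have hgen : s 0 ^ 3 * h 0 * s 0 * h 0 * s 0 = s 0 ^ 2 * h (0 : Fin 1) := by
    conv_rhs => rw [← s_mul_h_word 0]
    rw [pow_succ]
    simp only [mul_assoc]
  have hs4 : s 0 ^ 2 * s 0 ^ 2 = (1 : ProjCliff 1) := by rw [← pow_add, s_pow_four]
  refine index_two_of_involution (h_mul_self 0) ?_ ?_ ?_
  · rintro g rfl
    have he : h 0 * (s 0 ^ 3 * h 0 * s 0 * h 0 * s 0) * h 0 =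
        (s 0 ^ 3 * h 0 * s 0 * h 0 * s (0 : Fin 1))⁻¹ := by
      rw [hgen, eq_inv_iff_mul_eq_one]
      calc h 0 * (s 0 ^ 2 * h 0) * h 0 * (s 0 ^ 2 * h 0)
          = h 0 * s 0 ^ 2 * (h 0 * h 0) * s 0 ^ 2 * h (0 : Fin 1) := by simp only [mul_assoc]
        _ = h 0 * (s 0 ^ 2 * s 0 ^ 2) * h 0 := by rw [h_mul_self, mul_one]; simp only [mul_assoc]
        _ = 1 := by rw [hs4, mul_one, h_mul_self]
    rw [he]
    exact inv_mem (Subgroup.subset_closure rfl)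
  · refine h_notMem_of_fix 0 ?_
    rintro g rfl
    rw [hgen]
    simp only [act_mul, map_mul, act_s_sq_gX, act_s_sq_gZ, act_h_gX, act_h_gZ, if_pos, map_pow,
      act_omegaI]
    rw [mul_assoc, onQubit_gZ_mul_gX, ← mul_assoc, omegaI_pow_eight, one_mul]
  · refine finite_closure ?_
    have hs := s_mem_projDetFour (0 : Fin 1)
    have hh := h_mem_projDetFour (0 : Fin 1)
    rintro g (rfl | rfl)
    exacts [hh, mul_mem (mul_mem (mul_mem (mul_mem (pow_mem hs 3) hh) hs) hh) hs]

theorem F_two_index_two : F 2 ≤ IN 2 ∧ ((F 2).subgroupOf (IN 2)).Normal ∧ Finite (IN 2) ∧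
    2 * Nat.card (F 2) = Nat.card (IN 2) := by
  have h01 : (0 : Fin 2) ≠ 1 := by simp
  have hfin : ∀ g ∈ ({h 0, h 1, s 1, h 0 * s 0 ^ 2 * h 0, elemM 0} : Set (ProjCliff 2)),
      g ∈ projDetFour 2 := by
    have h0 := h_mem_projDetFour (0 : Fin 2)
    rintro g (rfl | rfl | rfl | rfl | rfl)
    exacts [h0, h_mem_projDetFour _, s_mem_projDetFour _,
      mul_mem (mul_mem h0 (pow_mem (s_mem_projDetFour _) 2)) h0, elemM_mem_projDetFour 0]
  refine index_two_of_involution (S := {h 1, s 1, h 0 * s 0 ^ 2 * h 0, elemM 0})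
    (h_mul_self 0) ?_ ?_ (finite_closure hfin)
  · have m1 : h 1 ∈ Subgroup.closure
        ({h 1, s 1, h 0 * s 0 ^ 2 * h 0, elemM 0} : Set (ProjCliff 2)) :=
      Subgroup.subset_closure (by simp)
    have m2 : s 1 ∈ Subgroup.closure
        ({h 1, s 1, h 0 * s 0 ^ 2 * h 0, elemM 0} : Set (ProjCliff 2)) :=
      Subgroup.subset_closure (by simp)
    have m3 : h 0 * s 0 ^ 2 * h 0 ∈ Subgroup.closure
        ({h 1, s 1, h 0 * s 0 ^ 2 * h 0, elemM 0} : Set (ProjCliff 2)) :=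
      Subgroup.subset_closure (by simp)
    have m4 : elemM 0 ∈ Subgroup.closure
        ({h 1, s 1, h 0 * s 0 ^ 2 * h 0, elemM 0} : Set (ProjCliff 2)) :=
      Subgroup.subset_closure (by simp)
    rintro g (rfl | rfl | rfl | rfl)
    · rwa [h_mul_mul_h_of_commute (h_commute_h h01)]
    · rwa [h_mul_mul_h_of_commute (h_commute_s h01)]
    -- This is the only generator that `h 0` neither fixes nor inverts: it exchanges the classes of
    -- `X₀` and `Z₀`.
    · have he : h 0 * (h 0 * s 0 ^ 2 * h 0) * h 0 = (s 0 ^ 2 : ProjCliff 2) := by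
        rw [mul_assoc, mul_assoc, mul_assoc, h_mul_self, mul_one, ← mul_assoc, h_mul_self, one_mul]
      rw [he]
      exact s_zero_sq_mem m1 m2 m3 m4
    · have he := h_mul_elemM_mul_h_eq 0
      rw [he]
      exact inv_mem m4
  · refine h_notMem_of_preservesTetrad (k := 0)
      (finite_closure fun g hg => hfin g (Set.mem_insert_of_mem _ hg)) ?_
    rintro g (rfl | rfl | rfl | rfl)
    exacts [preservesTetrad_h_one 0, preservesTetrad_s_one 0, preservesTetrad_x_zero 0,
      preservesTetrad_elemM 0]

theorem F_add_three_index_two (k : ℕ) : F (k + 3) ≤ IN (k + 3) ∧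
    ((F (k + 3)).subgroupOf (IN (k + 3))).Normal ∧ Finite (IN (k + 3)) ∧
    2 * Nat.card (F (k + 3)) = Nat.card (IN (k + 3)) := by
  rw [IN_add_three, F]
  -- A `cz i` with `i ≠ 0` does not touch qubit 0, so it commutes with `h 0` and fixes `X₀Z₀`.
  have hcz : ∀ i : Fin (k + 2), i ≠ 0 → (0 : Fin (k + 3)) ≠ i.castSucc ∧ (0 : Fin (k + 3)) ≠ i.succ :=
    fun i hi => ⟨fun he => hi (Fin.castSucc_eq_zero_iff.1 he.symm), (Fin.succ_ne_zero i).symm⟩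
  refine index_two_of_involution (h_mul_self 0) ?_ ?_ ?_
  · rintro g (((⟨i, hi, rfl⟩ | ⟨i, hi, rfl⟩) | rfl) | ⟨i, hi, rfl⟩)
    · rw [h_mul_mul_h_of_commute (h_commute_h hi.symm)]
      exact Subgroup.subset_closure (Or.inl (Or.inl (Or.inl ⟨i, hi, rfl⟩)))
    · rw [h_mul_mul_h_of_commute (h_commute_s hi.symm)]
      exact Subgroup.subset_closure (Or.inl (Or.inl (Or.inr ⟨i, hi, rfl⟩)))
    · have he := h_mul_elemM_mul_h_eq (k + 1)
      rw [he]
      exact inv_mem (Subgroup.subset_closure (Or.inl (Or.inr rfl)))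
    · rw [h_mul_mul_h_of_commute (h_commute_cz (hcz i hi).1 (hcz i hi).2)]
      exact Subgroup.subset_closure (Or.inr ⟨i, hi, rfl⟩)
  · refine h_notMem_of_fix 0 ?_
    rintro g (((⟨i, hi, rfl⟩ | ⟨i, hi, rfl⟩) | rfl) | ⟨i, hi, rfl⟩)
    · rw [map_mul, act_h_gX, act_h_gZ, if_neg hi, if_neg hi]
    · rw [map_mul, act_s_gX, act_s_gZ, if_neg hi]
    · exact act_elemM_fix (k + 1)
    · rw [map_mul, act_cz_gX, act_cz_gZ, if_neg (hcz i hi).1, if_neg (hcz i hi).2]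
  · refine finite_closure ?_
    rintro g (rfl | ((⟨i, hi, rfl⟩ | ⟨i, hi, rfl⟩) | rfl) | ⟨i, hi, rfl⟩)
    exacts [h_mem_projDetFour _, h_mem_projDetFour _, s_mem_projDetFour _,
      elemM_mem_projDetFour _, cz_mem_projDetFour _]

end QubitClifford

theorem mainTheorem7 (n : ℕ) (hn : 1 ≤ n) :
    QubitClifford.F n ≤ QubitClifford.IN n ∧
      ((QubitClifford.F n).subgroupOf (QubitClifford.IN n)).Normal ∧
      Finite (QubitClifford.IN n) ∧
      2 * Nat.card (QubitClifford.F n) = Nat.card (QubitClifford.IN n) := by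
  match n, hn with
  | 1, _ => exact QubitClifford.F_one_index_two
  | 2, _ => exact QubitClifford.F_two_index_two
  | k + 3, _ => exact QubitClifford.F_add_three_index_two k
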